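/- **Setting.** Let $\mathcal X$ be an infinite-dimensional separable real Hilbert space. Let $\mathcal C_0$ be a self-adjoint, positive-definite, trace class operator on $\mathcal X$ with orthonormal eigenbasis $\{\phi_k\}$ and eigenvalues $\lambda_k^2$; let $\mathcal C_1$ be a bounded, self-adjoint, positive-definite (not necessarily trace class) operator on $\mathcal X$; and let $\mathcal A\colon\mathcal D(\mathcal A)\subset\mathcal X\to\mathcal X$ be self-adjoint and positive-definite with bounded inverse. For $t\in\mathbb R$ let $X^t$ be the Hilbert scale of $\mathcal C_0$, with norm $\|u\|_t=\|\mathcal C_0^{-t/2}u\|=\big(\sum_k\lambda_k^{-2t}u_k^2\big)^{1/2}$, $u_k=\langle u,\phi_k\rangle$; its elements are identified with their coefficient sequences. Below, an operator composed of $\mathcal C_1^{\pm1/2},\mathcal C_1^{-1},\mathcal A^{-1}$ that is classically defined only on a subspace of $X^t$ is understood to be defined on a dense subspace and extended to $X^t$ by continuity. **Assumptions.** There are $s_0\in[0,1)$, $\beta,\ell\ge0$ and constants $c,c',c_1,\dots,c_4>0$ such that, with $\Delta:=2\ell-\beta+1$: 1. $\mathcal C_0^s$ is trace class for all $s>s_0$;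 2. $\Delta>2s_0$; 3. $c\,\|u\|_{\beta-2\ell}\le\|\mathcal C_1^{-1/2}\mathcal A^{-1}u\|\le c'\|u\|_{\beta-2\ell}$ for all $u\in X^{\beta-2\ell}$; in particular $\mathcal A^{-1}u\in\mathcal D(\mathcal C_1^{-1/2})$ for $u\in\mathcal X\cap X^{\beta-2\ell}$; 4. $\|\mathcal C_1^{1/2}u\|_\rho\le c_1\|u\|_{\rho-\beta}$ for all $u\in X^{\rho-\beta}$, $\rho\in[\lceil\beta-s_0-1\rceil,\beta-s_0)$; 5. $\|\mathcal C_1^{-1/2}u\|_{-s}\le c_2\|u\|_{\beta-s}$ for all $u\in X^{\beta-s}$, $s\in(s_0,1]$; 6. $\|\mathcal C_1^{-1/2}\mathcal A^{-1}u\|_{s}\le c_3\|u\|_{s+\beta-2\ell}$ for all $u\in X^{s+\beta-2\ell}$, $s\in(s_0,1]$; 7. $\|\mathcal A^{-1}\mathcal C_1^{-1}u\|_{-\eta}\le c_4\|u\|_{2\beta-2\ell-\eta}$ for all $u\in X^{2\beta-2\ell-\eta}$, $\eta\in[\beta-2\ell,1]$. **Data and posterior mean.** Let $u^\dagger\in\mathcal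 X$, and for $n\ge1$ let $y^\dagger=\mathcal A^{-1}u^\dagger+n^{-1/2}\xi$ with $\xi\sim\mathcal N(0,\mathcal C_1)$, that is, $\xi$ is a random coefficient sequence such that $\sum_k a_k\xi_k\sim\mathcal N(0,\langle\mathcal C_1v,v\rangle)$ for each finite combination $v=\sum_k a_k\phi_k$. For a prior scaling $\tau>0$ (prior $\mathcal N(0,\tau^2\mathcal C_0)$) put $\lambda=\frac1{n\tau^2}$. The posterior mean $m_\lambda^\dagger\in X^1$ is the weak solution of $(\mathcal A^{-1}\mathcal C_1^{-1}\mathcal A^{-1}+\lambda\mathcal C_0^{-1})m_\lambda^\dagger=\mathcal A^{-1}\mathcal C_1^{-1}y^\dagger$, i.e. $$\langle\mathcal C_1^{-1/2}\mathcal A^{-1}m_\lambda^\dagger,\mathcal C_1^{-1/2}\mathcal A^{-1}v\rangle+\lambda\langle\mathcal C_0^{-1/2}m_\lambda^\dagger,\mathcal C_0^{-1/2}v\rangle=\langle\mathcal A^{-1}\mathcal C_1^{-1}y^\dagger,v\rangle\qquad\forall v\in X^1,$$ where $\mathcal A^{-1}\mathcal C_1^{-1}$ is extended by continuity to an operator $X^{2\beta-2\ell-1}\to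 X^{-1}$. **Theorem.** Under these assumptions let $u^\dagger\in X^\gamma$ with $\gamma\ge1$, let $\theta\in[0,1]$, $\eta=(1-\theta)(\beta-2\ell)+\theta$, and let $\varepsilon>0$. For each choice of $\tau(n)$ below and every $n\ge1$, the posterior mean $m_\lambda^\dagger$ almost surely exists, is unique, and is a random variable, and there is a constant $c>0$ independent of $n\ge1$ such that: i) if $\gamma\in(1,\Delta+1]$ and $\tau(n)=n^{-\frac{\gamma-1+s_0+\varepsilon}{2(\Delta+\gamma-1+s_0+\varepsilon)}}$, then $\mathbb E\|m_\lambda^\dagger-u^\dagger\|_\eta^2\le c\,n^{-\frac{\Delta+\gamma-1-\theta\Delta}{\Delta+\gamma-1+s_0+\varepsilon}}$; ii) if $\gamma>\Delta+1$ and $\tau(n)=n^{-\frac{\Delta+s_0+\varepsilon}{2(2\Delta+s_0+\varepsilon)}}$, then $\mathbb E\|m_\lambda^\dagger-u^\dagger\|_\eta^2\le c\,n^{-\frac{(2-\theta)\Delta}{2\Delta+s_0+\varepsilon}}$; iii) if $\gamma=1$, $\theta\in[0,1)$ and $\tau(n)=n^{-\frac{s_0+\varepsilon}{2(\Delta+s_0+\varepsilon)}}$,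 then $\mathbb E\|m_\lambda^\dagger-u^\dagger\|_\eta^2\le c\,n^{-\frac{(1-\theta)\Delta}{\Delta+s_0+\varepsilon}}$. -/

import Mathlib

open MeasureTheory ProbabilityTheory Filter Topology Set
open scoped ENNReal NNReal InnerProductSpace

noncomputable section

/-- The operators of the linear inverse problem `y = A⁻¹ u + n^{-1/2} ξ` on an infinite-dimensional
separable real Hilbert space `X`, with prior `N(0, τ² C₀)` and noise `ξ ∼ N(0, C₁)`. -/
structure InverseProblem (X : Type*) [NormedAddCommGroup X] [InnerProductSpace ℝ X]
    [CompleteSpace X] where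
  /-- The prior covariance operator. -/
  C₀ : X →L[ℝ] X
  /-- An orthonormal basis of eigenvectors of `C₀`. -/
  φ : HilbertBasis ℕ ℝ X
  /-- The square roots `λ_k` of the eigenvalues of `C₀`. -/
  lam : ℕ → ℝ
  /-- `C₀` is positive definite. -/
  lam_pos : ∀ k, 0 < lam k
  /-- The eigenvalue relation; in particular `C₀` is self-adjoint. -/
  C₀_apply : ∀ k, C₀ (φ k) = (lam k ^ 2) • φ k
  /-- `C₀` is trace class. -/
  C₀_trace : Summable fun k => lam k ^ 2
  /-- The noise covariance operator, bounded but not necessarily trace class. -/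
  C₁ : X →L[ℝ] X
  C₁_selfAdjoint : IsSelfAdjoint C₁
  C₁_posDef : ∀ x, x ≠ 0 → 0 < ⟪C₁ x, x⟫_ℝ
  /-- The (unique) positive square root of `C₁`. -/
  sqrtC₁ : X →L[ℝ] X
  sqrtC₁_pos : sqrtC₁.IsPositive
  sqrtC₁_sq : sqrtC₁ ∘L sqrtC₁ = C₁
  /-- The operator `A`, unbounded in general. -/
  A : X →ₗ.[ℝ] X
  A_dense : Dense (A.domain : Set X)
  A_selfAdjoint : IsSelfAdjoint A
  A_posDef : ∀ u : A.domain, (u : X) ≠ 0 → 0 < ⟪A u, (u : X)⟫_ℝ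
  /-- The bounded inverse of `A`. -/
  Ainv : X →L[ℝ] X
  Ainv_mem : ∀ x, Ainv x ∈ A.domain
  A_Ainv : ∀ x, A ⟨Ainv x, Ainv_mem x⟩ = x
  Ainv_A : ∀ u : A.domain, Ainv (A u) = u

namespace InverseProblem

variable {X : Type*} [NormedAddCommGroup X] [InnerProductSpace ℝ X] [CompleteSpace X]
variable (M : InverseProblem X)

/-- The coefficients of a vector in the eigenbasis of `C₀`. -/
def coef (u : X) : ℕ → ℝ := fun k => ⟪M.φ k, u⟫_ℝ

/-- The norm `‖a‖_t = ‖C₀^{-t/2} a‖` of the Hilbert scale, for an element given by its coefficients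
in the eigenbasis of `C₀` (where `C₀^{-t/2} φ_k = λ_k^{-t} φ_k`); it is `∞` outside `X^t`. Elements
of `X^t` with `t < 0` need not be vectors of `X`, so they are represented by their coefficients. -/
def scaleNorm (t : ℝ) (a : ℕ → ℝ) : ℝ≥0∞ :=
  (∑' k, ENNReal.ofReal (M.lam k ^ (-2 * t) * a k ^ 2)) ^ (1 / 2 : ℝ)

/-- Membership in `X^t`, the completion of `⋂_l D(C₀^{-l})` in `‖·‖_t`. -/
def MemScale (t : ℝ) (a : ℕ → ℝ) : Prop := M.scaleNorm t a < ∞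

/-- The operator `C₁^{-1/2}`; the value is meaningful on its domain, the range of `C₁^{1/2}`. -/
def invSqrtC₁ (x : X) : X := Function.invFun M.sqrtC₁ x

/-- The operator `Q P⁻¹`, with domain the range of `P`, acts as a bounded operator from `X^t`
to `X^r` with constant `c`: its domain meets `X^t` in a dense subspace, and the bound
`‖Q P⁻¹ u‖_r ≤ c ‖u‖_t` holds there, so that it extends to all `u ∈ X^t` by continuity. -/
def ExtendsBounded (P Q : X →L[ℝ] X) (t r : ℝ) (c : ℝ≥0) : Prop :=
  (∀ a : ℕ → ℝ, M.MemScale t a → ∀ δ : ℝ≥0∞, 0 < δ →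
    ∃ x : X, M.scaleNorm t (M.coef (P x) - a) < δ) ∧
  ∀ x : X, M.scaleNorm r (M.coef (Q x)) ≤ c * M.scaleNorm t (M.coef (P x))

/-- The standing assumptions relating `C₀`, `C₁` and `A⁻¹`, with `Δ = 2ℓ - β + 1`. -/
structure Assumptions (s₀ β ℓ : ℝ) : Prop where
  s₀_nonneg : 0 ≤ s₀
  s₀_lt_one : s₀ < 1
  β_nonneg : 0 ≤ β
  ℓ_nonneg : 0 ≤ ℓ
  /-- `C₀^s` is trace class for all `s > s₀`. -/
  trace : ∀ s, s₀ < s → Summable fun k => M.lam k ^ (2 * s)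
  /-- `Δ > 2 s₀`. -/
  illposed : 2 * s₀ < 2 * ℓ - β + 1
  /-- `‖C₁^{-1/2} A⁻¹ u‖ ≍ ‖C₀^{ℓ-β/2} u‖` on `X^{β-2ℓ}` (it suffices to say this for the elements
  that are vectors of `X`, since these are dense). -/
  forward : ∃ c c' : ℝ≥0, 0 < c ∧ 0 < c' ∧ ∀ u : X, M.MemScale (β - 2 * ℓ) (M.coef u) →
    M.Ainv u ∈ range M.sqrtC₁ ∧
    c * M.scaleNorm (β - 2 * ℓ) (M.coef u) ≤ ‖M.invSqrtC₁ (M.Ainv u)‖ₑ ∧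
    ‖M.invSqrtC₁ (M.Ainv u)‖ₑ ≤ c' * M.scaleNorm (β - 2 * ℓ) (M.coef u)
  /-- `‖C₀^{-ρ/2} C₁^{1/2} u‖ ≤ c₁ ‖C₀^{(β-ρ)/2} u‖` on `X^{ρ-β}`. -/
  noise : ∃ c₁ : ℝ≥0, 0 < c₁ ∧ ∀ ρ ∈ Ico (⌈β - s₀ - 1⌉ : ℝ) (β - s₀),
    M.ExtendsBounded (ContinuousLinearMap.id ℝ X) M.sqrtC₁ (ρ - β) ρ c₁
  /-- `‖C₀^{s/2} C₁^{-1/2} u‖ ≤ c₂ ‖C₀^{(s-β)/2} u‖` on `X^{β-s}`. -/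
  noise_inv : ∃ c₂ : ℝ≥0, 0 < c₂ ∧ ∀ s ∈ Ioc s₀ 1,
    M.ExtendsBounded M.sqrtC₁ (ContinuousLinearMap.id ℝ X) (β - s) (-s) c₂
  /-- `‖C₀^{-s/2} C₁^{-1/2} A⁻¹ u‖ ≤ c₃ ‖C₀^{(2ℓ-β-s)/2} u‖` on `X^{s+β-2ℓ}` (again stated on the
  dense subspace of vectors of `X`). -/
  forward_reg : ∃ c₃ : ℝ≥0, 0 < c₃ ∧ ∀ s ∈ Ioc s₀ 1, ∀ u : X,
    M.MemScale (s + β - 2 * ℓ) (M.coef u) →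
    M.Ainv u ∈ range M.sqrtC₁ ∧
    M.scaleNorm s (M.coef (M.invSqrtC₁ (M.Ainv u))) ≤
      c₃ * M.scaleNorm (s + β - 2 * ℓ) (M.coef u)
  /-- `‖C₀^{η/2} A⁻¹ C₁⁻¹ u‖ ≤ c₄ ‖C₀^{η/2+ℓ-β} u‖` on `X^{2β-2ℓ-η}`. -/
  data : ∃ c₄ : ℝ≥0, 0 < c₄ ∧ ∀ η ∈ Icc (β - 2 * ℓ) 1,
    M.ExtendsBounded M.C₁ M.Ainv (2 * β - 2 * ℓ - η) (-η) c₄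

/-- `ξ ∼ N(0, C₁)`, as a random sequence of coefficients in the eigenbasis of `C₀` (`ξ` need not take
values in `X`): for every finite combination `v = ∑ a_k φ_k` the variable `∑ a_k ξ_k`, which stands
for `⟨ξ, v⟩`, has law `N(0, ⟨C₁ v, v⟩)`. -/
def IsNoise {Ω : Type*} [MeasurableSpace Ω] (P : Measure Ω) (ξ : Ω → ℕ → ℝ) : Prop :=
  ∀ a : ℕ →₀ ℝ,
    HasLaw (fun ω => a.sum fun k c => c * ξ ω k)
      (gaussianReal 0 (⟪M.C₁ (a.sum fun k c => c • M.φ k), a.sum fun k c => c • M.φ k⟫_ℝ).toNNReal)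
      P

/-- The data `y† = A⁻¹ u† + n^{-1/2} ξ`, in coefficients. -/
def data (u : X) (n : ℝ) (ξ : ℕ → ℝ) : ℕ → ℝ :=
  fun k => M.coef (M.Ainv u) k + (Real.sqrt n)⁻¹ * ξ k

/-- The bilinear form
`B(w,v) = ⟨C₁^{-1/2} A⁻¹ w, C₁^{-1/2} A⁻¹ v⟩ + Λ ⟨C₀^{-1/2} w, C₀^{-1/2} v⟩` on `X^1`. -/
def form (Λ : ℝ) (w v : X) : ℝ :=
  ⟪M.invSqrtC₁ (M.Ainv w), M.invSqrtC₁ (M.Ainv v)⟫_ℝ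
    + Λ * ∑' k, M.lam k ^ (-2 : ℝ) * (M.coef w k * M.coef v k)

/-- `w ∈ X^1` is a weak solution of `(A⁻¹ C₁⁻¹ A⁻¹ + Λ C₀⁻¹) w = r`, where `r ∈ X^{-1}`. -/
def IsWeakSolution (Λ : ℝ) (r : ℕ → ℝ) (w : X) : Prop :=
  M.MemScale (-1) r ∧ M.MemScale 1 (M.coef w) ∧
  ∀ v : X, M.MemScale 1 (M.coef v) → M.form Λ w v = ∑' k, r k * M.coef v k

/-- `r = A⁻¹ C₁⁻¹ y`, where `A⁻¹ C₁⁻¹` is extended by continuity to a map from `X^{2β-2ℓ-1}` to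
`X^{-1}`. -/
def IsAinvC₁inv (β ℓ : ℝ) (y r : ℕ → ℝ) : Prop :=
  M.MemScale (2 * β - 2 * ℓ - 1) y ∧ M.MemScale (-1) r ∧ ∃ x : ℕ → X,
    Tendsto (fun j => M.scaleNorm (2 * β - 2 * ℓ - 1) (M.coef (M.C₁ (x j)) - y)) atTop (𝓝 0) ∧
    Tendsto (fun j => M.scaleNorm (-1) (M.coef (M.Ainv (x j)) - r)) atTop (𝓝 0)

/-- `w` is a posterior mean for the data `y` and `Λ = 1/(n τ²)`: a weak solution of
`(A⁻¹ C₁⁻¹ A⁻¹ + Λ C₀⁻¹) w = A⁻¹ C₁⁻¹ y`. -/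
def IsPosteriorMean (β ℓ Λ : ℝ) (y : ℕ → ℝ) (w : X) : Prop :=
  ∃ r, M.IsAinvC₁inv β ℓ y r ∧ M.IsWeakSolution Λ r w

/-- The posterior mean (meaningful for those data `y` for which it exists and is unique). -/
def posteriorMean (β ℓ Λ : ℝ) (y : ℕ → ℝ) : X :=
  Classical.epsilon fun w => M.IsPosteriorMean β ℓ Λ y w

/-- With the prior scaling `τ = τ(n)` and `Λ = 1/(n τ²)`, the posterior mean `m` for the data `y†` is
almost surely well defined, it is a random variable, and `E ‖m - u†‖_η² ≤ c · rate(n)` with a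
constant `c` independent of `n ≥ 1`. -/
def MeanErrorRate (β ℓ : ℝ) {Ω : Type*} [MeasurableSpace Ω] (P : Measure Ω) (ξ : Ω → ℕ → ℝ)
    (u : X) (η : ℝ) (τ rate : ℝ → ℝ) : Prop :=
  ∃ c : ℝ, 0 < c ∧ ∀ n : ℝ, 1 ≤ n →
    (∀ᵐ ω ∂P, ∃! w : X, M.IsPosteriorMean β ℓ (1 / (n * τ n ^ 2)) (M.data u n (ξ ω)) w) ∧
    AEStronglyMeasurable
      (fun ω => M.posteriorMean β ℓ (1 / (n * τ n ^ 2)) (M.data u n (ξ ω))) P ∧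
    ∫⁻ ω, M.scaleNorm η
      (M.coef (M.posteriorMean β ℓ (1 / (n * τ n ^ 2)) (M.data u n (ξ ω)) - u)) ^ 2 ∂P
      ≤ ENNReal.ofReal (c * rate n)

end InverseProblem

end

namespace InverseProblem

variable {X : Type*} [NormedAddCommGroup X] [InnerProductSpace ℝ X] [CompleteSpace X]
variable (M : InverseProblem X)

/-! ### Coefficients and the Hilbert scale -/

/-! The proof is an energy estimate. Write K = C₁^{-1/2} A⁻¹, κ = β - 2ℓ = 1 - Δ, w for the
posterior mean, z = n^{-1/2} ξ and e = w - u†. Testing the weak equation with e gives ‖Ke‖² + Λ‖e‖₁²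
= (B(w,e) - ⟨Ku†,Ke⟩) - Λ⟨C₀^{-1/2}u†, C₀^{-1/2}e⟩. The left side dominates N² = ‖e‖_κ² + Λ‖e‖₁² up
to a constant. On the right, the noise term is at most C‖z‖_{β-s}‖e‖_{s+κ}
(`exists_abs_form_sub_le`) and the prior term at most Λ‖u†‖_γ‖e‖_{2-γ}. The indices s+κ and 2-γ lie
between κ and 1, so interpolation bounds both norms of e by a negative power of Λ times N. One
factor N cancels, and interpolating once more gives the η-norm of e (`exists_error_le`).

The noise enters only through E‖ξ‖²_{β-s}, which is finite for suitable s > s₀ because C₀^s is trace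
class (`lintegral_scaleNorm_noise_lt_top`). The choice of τ(n) makes Λ the power of n that balances
squared bias and variance when s = s₀ + ε.

Well-posedness comes from Lax–Milgram in X^1, from the boundedness of the extension of A⁻¹C₁⁻¹, and
from the linear dependence of w on the data. Measurability follows since w is the limit of the
posterior means for truncated data. -/

lemma coef_add (x y : X) : M.coef (x + y) = M.coef x + M.coef y := by
  funext k; simp [coef, inner_add_right]

lemma coef_sub (x y : X) : M.coef (x - y) = M.coef x - M.coef y := by
  funext k; simp [coef, inner_sub_right]

lemma coef_smul (c : ℝ) (x : X) : M.coef (c • x) = c • M.coef x := by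
  funext k; simp [coef, inner_smul_right]

lemma hasSum_coef_mul_coef (x y : X) :
    HasSum (fun k => M.coef x k * M.coef y k) ⟪x, y⟫_ℝ := by
  simpa only [coef, real_inner_comm x] using M.φ.hasSum_inner_mul_inner x y

lemma coef_injective : Function.Injective M.coef := by
  intro x y h
  have h1 : M.coef (x - y) = 0 := by rw [coef_sub, h, sub_self]
  have h2 := M.hasSum_coef_mul_coef (x - y) (x - y)
  simp only [h1, Pi.zero_apply, mul_zero] at h2
  exact sub_eq_zero.1 (inner_self_eq_zero.1 (h2.unique hasSum_zero))

lemma lam_rpow_pos (k : ℕ) (t : ℝ) : 0 < M.lam k ^ t := Real.rpow_pos_of_pos (M.lam_pos k) t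

lemma lam_rpow_mul_neg (k : ℕ) (t : ℝ) : M.lam k ^ t * M.lam k ^ (-t) = 1 := by
  rw [← Real.rpow_add (M.lam_pos k), add_neg_cancel, Real.rpow_zero]

lemma lam_rpow_neg_mul (k : ℕ) (t : ℝ) : M.lam k ^ (-t) * M.lam k ^ t = 1 := by
  rw [mul_comm, lam_rpow_mul_neg]

lemma weight_eq_sq (k : ℕ) (t x : ℝ) :
    M.lam k ^ (-2 * t) * x ^ 2 = (M.lam k ^ (-t) * x) ^ 2 := by
  rw [mul_pow, ← Real.rpow_mul_natCast (M.lam_pos k).le]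
  congr 2; push_cast; ring

lemma scaleNorm_sq (t : ℝ) (a : ℕ → ℝ) :
    M.scaleNorm t a ^ 2 = ∑' k, ENNReal.ofReal (M.lam k ^ (-2 * t) * a k ^ 2) := by
  rw [scaleNorm, ← ENNReal.rpow_natCast, ← ENNReal.rpow_mul]
  norm_num

/-- Multiplication of the coefficients by `λ_k^{-t}` maps `X^t` isometrically to `X`. -/
lemma scaleNorm_eq_enorm {t : ℝ} {a : ℕ → ℝ} {x : X}
    (h : ∀ k, M.coef x k = M.lam k ^ (-t) * a k) : M.scaleNorm t a = ‖x‖ₑ := by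
  have h1 := M.hasSum_coef_mul_coef x x
  have h2 : ∑' k, ENNReal.ofReal (M.lam k ^ (-2 * t) * a k ^ 2) = ENNReal.ofReal (‖x‖ ^ 2) := by
    rw [← real_inner_self_eq_norm_sq, ← h1.tsum_eq, ENNReal.ofReal_tsum_of_nonneg _ h1.summable]
    · refine tsum_congr fun k => ?_
      rw [weight_eq_sq, h, sq]
    · intro k; exact mul_self_nonneg _
  rw [scaleNorm, h2, ENNReal.ofReal_rpow_of_nonneg (by positivity) (by norm_num),
    ← Real.sqrt_eq_rpow, Real.sqrt_sq (norm_nonneg _), ofReal_norm]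

lemma exists_vector_of_memScale {t : ℝ} {a : ℕ → ℝ} (h : M.MemScale t a) :
    ∃ x : X, ∀ k, M.coef x k = M.lam k ^ (-t) * a k := by
  have h1 : ∑' k, ENNReal.ofReal (M.lam k ^ (-2 * t) * a k ^ 2) ≠ ∞ := by
    rw [← scaleNorm_sq]; exact ENNReal.pow_ne_top h.ne
  have h2 : Summable fun k => (M.lam k ^ (-t) * a k) ^ 2 := by
    have := ENNReal.summable_toReal h1
    refine this.congr fun k => ?_
    rw [ENNReal.toReal_ofReal, weight_eq_sq]
    rw [weight_eq_sq]; positivity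
  have h3 : Memℓp (fun k => M.lam k ^ (-t) * a k) 2 := by
    refine (memℓp_gen_iff (by norm_num)).2 (h2.congr fun k => ?_)
    rw [ENNReal.toReal_ofNat, Real.rpow_two, Real.norm_eq_abs, sq_abs]
  refine ⟨M.φ.repr.symm ⟨_, h3⟩, fun k => ?_⟩
  rw [coef, ← HilbertBasis.repr_apply_apply, LinearIsometryEquiv.apply_symm_apply]

lemma memScale_of_vector {t : ℝ} {a : ℕ → ℝ} {x : X}
    (h : ∀ k, M.coef x k = M.lam k ^ (-t) * a k) : M.MemScale t a := by
  rw [MemScale, M.scaleNorm_eq_enorm h]; exact enorm_lt_top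

lemma scaleNorm_zero_coef (x : X) : M.scaleNorm 0 (M.coef x) = ‖x‖ₑ :=
  M.scaleNorm_eq_enorm (by simp)

lemma memScale_zero_coef (x : X) : M.MemScale 0 (M.coef x) := by
  rw [MemScale, scaleNorm_zero_coef]; exact enorm_lt_top

/-- The sequence with `‖·‖_t`-isometric image `x`. -/
lemma exists_seq_of_vector (t : ℝ) (x : X) :
    ∃ a : ℕ → ℝ, ∀ k, M.coef x k = M.lam k ^ (-t) * a k := by
  refine ⟨fun k => M.lam k ^ t * M.coef x k, fun k => ?_⟩
  rw [← mul_assoc, lam_rpow_neg_mul, one_mul]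

lemma scaleNorm_add_le (t : ℝ) (a b : ℕ → ℝ) :
    M.scaleNorm t (a + b) ≤ M.scaleNorm t a + M.scaleNorm t b := by
  rcases eq_top_or_lt_top (M.scaleNorm t a) with h | ha
  · simp [h]
  rcases eq_top_or_lt_top (M.scaleNorm t b) with h | hb
  · simp [h]
  obtain ⟨x, hx⟩ := M.exists_vector_of_memScale ha
  obtain ⟨y, hy⟩ := M.exists_vector_of_memScale hb
  have hxy : ∀ k, M.coef (x + y) k = M.lam k ^ (-t) * (a + b) k := fun k => by
    rw [coef_add, Pi.add_apply, hx, hy, Pi.add_apply, mul_add]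
  rw [M.scaleNorm_eq_enorm hx, M.scaleNorm_eq_enorm hy, M.scaleNorm_eq_enorm hxy]
  exact enorm_add_le x y

lemma scaleNorm_smul (t c : ℝ) (a : ℕ → ℝ) :
    M.scaleNorm t (c • a) = ‖c‖ₑ * M.scaleNorm t a := by
  have h : ∀ k, ENNReal.ofReal (M.lam k ^ (-2 * t) * (c • a) k ^ 2)
      = ‖c‖ₑ ^ 2 * ENNReal.ofReal (M.lam k ^ (-2 * t) * a k ^ 2) := fun k => by
    rw [← ofReal_norm, ← ENNReal.ofReal_pow (norm_nonneg _),
      ← ENNReal.ofReal_mul (by positivity), Real.norm_eq_abs, sq_abs]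
    congr 1
    simp only [Pi.smul_apply, smul_eq_mul]; ring
  simp only [scaleNorm, h]
  rw [ENNReal.tsum_mul_left, ENNReal.mul_rpow_of_nonneg _ _ (by norm_num), ← ENNReal.rpow_natCast,
    ← ENNReal.rpow_mul]
  norm_num

lemma scaleNorm_neg (t : ℝ) (a : ℕ → ℝ) : M.scaleNorm t (-a) = M.scaleNorm t a := by
  simp [scaleNorm]

lemma scaleNorm_sub_comm (t : ℝ) (a b : ℕ → ℝ) : M.scaleNorm t (a - b) = M.scaleNorm t (b - a) := by
  rw [← scaleNorm_neg, neg_sub]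

lemma scaleNorm_sub_le (t : ℝ) (a b c : ℕ → ℝ) :
    M.scaleNorm t (a - c) ≤ M.scaleNorm t (a - b) + M.scaleNorm t (b - c) := by
  simpa using M.scaleNorm_add_le t (a - b) (b - c)

variable {M}

lemma MemScale.add {t : ℝ} {a b : ℕ → ℝ} (ha : M.MemScale t a) (hb : M.MemScale t b) :
    M.MemScale t (a + b) :=
  (M.scaleNorm_add_le t a b).trans_lt (ENNReal.add_lt_top.2 ⟨ha, hb⟩)

lemma MemScale.smul {t : ℝ} (c : ℝ) {a : ℕ → ℝ} (ha : M.MemScale t a) : M.MemScale t (c • a) := by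
  rw [MemScale, scaleNorm_smul]; exact ENNReal.mul_lt_top enorm_lt_top ha

lemma MemScale.sub {t : ℝ} {a b : ℕ → ℝ} (ha : M.MemScale t a) (hb : M.MemScale t b) :
    M.MemScale t (a - b) := by
  simpa [sub_eq_add_neg] using ha.add (hb.smul (-1))

/-! ### Duality, embeddings, interpolation and completeness of the scale -/

variable (M)

/-- The pairing of `X^{-t}` and `X^t`. -/
lemma hasSum_mul_of_vector {t : ℝ} {a b : ℕ → ℝ} {x y : X}
    (hx : ∀ k, M.coef x k = M.lam k ^ (-(-t)) * a k) (hy : ∀ k, M.coef y k = M.lam k ^ (-t) * b k) :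
    HasSum (fun k => a k * b k) ⟪x, y⟫_ℝ := by
  convert M.hasSum_coef_mul_coef x y using 2 with k
  rw [hx, hy, neg_neg]
  linear_combination (-(a k * b k)) * M.lam_rpow_mul_neg k t

lemma summable_mul {t : ℝ} {a b : ℕ → ℝ} (ha : M.MemScale (-t) a) (hb : M.MemScale t b) :
    Summable fun k => a k * b k := by
  obtain ⟨x, hx⟩ := M.exists_vector_of_memScale ha
  obtain ⟨y, hy⟩ := M.exists_vector_of_memScale hb
  exact (M.hasSum_mul_of_vector hx hy).summable

lemma abs_tsum_mul_le {t : ℝ} {a b : ℕ → ℝ} (ha : M.MemScale (-t) a) (hb : M.MemScale t b) :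
    |∑' k, a k * b k| ≤ (M.scaleNorm (-t) a).toReal * (M.scaleNorm t b).toReal := by
  obtain ⟨x, hx⟩ := M.exists_vector_of_memScale ha
  obtain ⟨y, hy⟩ := M.exists_vector_of_memScale hb
  rw [(M.hasSum_mul_of_vector hx hy).tsum_eq, M.scaleNorm_eq_enorm hx, M.scaleNorm_eq_enorm hy,
    toReal_enorm, toReal_enorm]
  exact abs_real_inner_le_norm x y

lemma hasSum_sq_of_memScale {t : ℝ} {a : ℕ → ℝ} (ha : M.MemScale t a) :
    HasSum (fun k => M.lam k ^ (-2 * t) * (a k * a k)) ((M.scaleNorm t a).toReal ^ 2) := by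
  obtain ⟨x, hx⟩ := M.exists_vector_of_memScale ha
  rw [M.scaleNorm_eq_enorm hx, toReal_enorm, ← real_inner_self_eq_norm_sq]
  convert M.hasSum_coef_mul_coef x x using 2 with k
  rw [hx, ← sq, weight_eq_sq, sq]

lemma exists_lam_le : ∃ C : ℝ, 1 ≤ C ∧ ∀ k, M.lam k ≤ C := by
  obtain ⟨C, hC⟩ := M.C₀_trace.tendsto_atTop_zero.bddAbove_range
  -- `C` bounds λ_k². Either λ_k ≤ 1, or λ_k ≤ λ_k² ≤ `C`.
  refine ⟨max C 1, le_max_right _ _, fun k => ?_⟩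
  have h1 : M.lam k ^ 2 ≤ C := hC ⟨k, rfl⟩
  rcases le_total (M.lam k) 1 with h | h
  · exact h.trans (le_max_right _ _)
  · exact le_trans (by nlinarith) (h1.trans (le_max_left _ _))

/-- The weights satisfy λ_k^{-t} = λ_k^{t'-t} λ_k^{-t'}, and λ_k^{t'-t} is bounded uniformly in k
since t' - t ≥ 0. -/
lemma exists_scaleNorm_le {t t' : ℝ} (h : t ≤ t') :
    ∃ C : ℝ≥0, 0 < C ∧ ∀ a, M.scaleNorm t a ≤ C * M.scaleNorm t' a := by
  obtain ⟨C, hC1, hC⟩ := M.exists_lam_le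
  have hC0 : 0 < C := zero_lt_one.trans_le hC1
  refine ⟨(C ^ (t' - t)).toNNReal, Real.toNNReal_pos.2 (Real.rpow_pos_of_pos hC0 _), fun a => ?_⟩
  rw [← ENNReal.pow_le_pow_left_iff two_ne_zero]
  rw [mul_pow, scaleNorm_sq, scaleNorm_sq, ← ENNReal.tsum_mul_left]
  refine ENNReal.tsum_le_tsum fun k => ?_
  change _ ≤ ENNReal.ofReal (C ^ (t' - t)) ^ 2 * _
  rw [← ENNReal.ofReal_pow (Real.rpow_pos_of_pos hC0 _).le,
    ← ENNReal.ofReal_mul (by positivity)]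
  refine ENNReal.ofReal_le_ofReal ?_
  rw [weight_eq_sq, weight_eq_sq, ← mul_pow, sq_le_sq, abs_mul, abs_mul, abs_mul,
    abs_of_pos (M.lam_rpow_pos k _), abs_of_pos (M.lam_rpow_pos k _),
    abs_of_pos (Real.rpow_pos_of_pos hC0 _), ← mul_assoc]
  refine mul_le_mul_of_nonneg_right ?_ (abs_nonneg _)
  have h2 : M.lam k ^ (-t) = M.lam k ^ (t' - t) * M.lam k ^ (-t') := by
    rw [← Real.rpow_add (M.lam_pos k)]; congr 1; ring
  rw [h2]
  exact mul_le_mul_of_nonneg_right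
    (Real.rpow_le_rpow (M.lam_pos k).le (hC k) (sub_nonneg.2 h)) (M.lam_rpow_pos k _).le

variable {M}

lemma MemScale.mono {t t' : ℝ} (h : t ≤ t') {a : ℕ → ℝ} (ha : M.MemScale t' a) :
    M.MemScale t a := by
  obtain ⟨C, -, hC⟩ := M.exists_scaleNorm_le h
  exact (hC a).trans_lt (ENNReal.mul_lt_top ENNReal.coe_lt_top ha)

variable (M)

/-- Interpolation in the Hilbert scale. -/
lemma scaleNorm_interpolation (p q : ℝ) {θ : ℝ} (h0 : 0 ≤ θ) (h1 : θ ≤ 1) (a : ℕ → ℝ) :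
    M.scaleNorm ((1 - θ) * p + θ * q) a ≤ M.scaleNorm p a ^ (1 - θ) * M.scaleNorm q a ^ θ := by
  have key : ∑' k, ENNReal.ofReal (M.lam k ^ (-2 * ((1 - θ) * p + θ * q)) * a k ^ 2) ≤
      (∑' k, ENNReal.ofReal (M.lam k ^ (-2 * p) * a k ^ 2)) ^ (1 - θ) *
      (∑' k, ENNReal.ofReal (M.lam k ^ (-2 * q) * a k ^ 2)) ^ θ := by
    -- Hölder's inequality for counting measure, applied to the terms of the two squared norms with
    -- exponents 1 - θ and θ. The square root is taken at the end.
    have := ENNReal.lintegral_mul_norm_pow_le (μ := Measure.count)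
      (f := fun k : ℕ => ENNReal.ofReal (M.lam k ^ (-2 * p) * a k ^ 2))
      (g := fun k : ℕ => ENNReal.ofReal (M.lam k ^ (-2 * q) * a k ^ 2))
      (measurable_of_countable _).aemeasurable (measurable_of_countable _).aemeasurable
      (sub_nonneg.2 h1) h0 (by ring)
    rw [lintegral_count, lintegral_count, lintegral_count] at this
    refine le_trans (ENNReal.tsum_le_tsum fun k => le_of_eq ?_) this
    have hp := M.lam_rpow_pos k (-2 * p)
    have hq := M.lam_rpow_pos k (-2 * q)
    rw [ENNReal.ofReal_rpow_of_nonneg (by positivity) (sub_nonneg.2 h1),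
      ENNReal.ofReal_rpow_of_nonneg (by positivity) h0, ← ENNReal.ofReal_mul (by positivity),
      Real.mul_rpow hp.le (sq_nonneg _), Real.mul_rpow hq.le (sq_nonneg _)]
    congr 1
    rw [mul_mul_mul_comm, ← Real.rpow_mul (M.lam_pos k).le, ← Real.rpow_mul (M.lam_pos k).le,
      ← Real.rpow_add (M.lam_pos k), ← Real.rpow_add_of_nonneg (sq_nonneg _) (sub_nonneg.2 h1) h0]
    rw [show 1 - θ + θ = 1 by ring, Real.rpow_one]
    congr 2; ring
  have := ENNReal.rpow_le_rpow key (show (0 : ℝ) ≤ 1 / 2 by norm_num)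
  rw [ENNReal.mul_rpow_of_nonneg _ _ (by norm_num), ← ENNReal.rpow_mul, ← ENNReal.rpow_mul,
    mul_comm (1 - θ) (1 / 2), mul_comm θ (1 / 2), ENNReal.rpow_mul, ENNReal.rpow_mul] at this
  exact this

/-- Completeness of `X^t`. -/
lemma exists_tendsto_of_cauchy {t : ℝ} {a : ℕ → ℕ → ℝ} (ha : ∀ j, M.MemScale t (a j))
    {b : ℕ → ℝ≥0∞} (hb : Tendsto b atTop (𝓝 0))
    (hab : ∀ i j, M.scaleNorm t (a i - a j) ≤ b i + b j) :
    ∃ r, M.MemScale t r ∧ Tendsto (fun j => M.scaleNorm t (a j - r)) atTop (𝓝 0) := by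
  choose x hx using fun j => M.exists_vector_of_memScale (ha j)
  have hsub : ∀ {x y : X} {a b : ℕ → ℝ}, (∀ k, M.coef x k = M.lam k ^ (-t) * a k) →
      (∀ k, M.coef y k = M.lam k ^ (-t) * b k) → M.scaleNorm t (a - b) = ‖x - y‖ₑ := by
    intro x y a b h1 h2
    refine M.scaleNorm_eq_enorm fun k => ?_
    rw [coef_sub, Pi.sub_apply, Pi.sub_apply, h1, h2, mul_sub]
  have hc : CauchySeq x := by
    rw [EMetric.cauchySeq_iff]
    intro δ hδ
    have h2 : ∀ᶠ j in atTop, b j < δ / 2 := hb.eventually_lt_const (ENNReal.half_pos hδ.ne')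
    obtain ⟨N, hN⟩ := eventually_atTop.1 h2
    refine ⟨N, fun m hm n hn => ?_⟩
    rw [edist_eq_enorm_sub, ← hsub (hx m) (hx n)]
    calc _ ≤ b m + b n := hab m n
      _ < δ / 2 + δ / 2 := ENNReal.add_lt_add (hN m hm) (hN n hn)
      _ = δ := ENNReal.add_halves δ
  obtain ⟨z, hz⟩ := cauchySeq_tendsto_of_complete hc
  obtain ⟨r, hr⟩ := M.exists_seq_of_vector t z
  refine ⟨r, M.memScale_of_vector hr, ?_⟩
  have := tendsto_iff_edist_tendsto_0.1 hz
  refine this.congr fun j => ?_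
  rw [edist_eq_enorm_sub, hsub (hx j) hr]

/-- A sequence in `X^t` is the limit of its truncations. -/
lemma tendsto_truncation {t : ℝ} {a : ℕ → ℝ} (ha : M.MemScale t a) :
    Tendsto (fun N => M.scaleNorm t ((∑ j ∈ Finset.range N, a j • Pi.single j (1 : ℝ)) - a)) atTop
      (𝓝 0) := by
  obtain ⟨x, hx⟩ := M.exists_vector_of_memScale ha
  have h := tendsto_iff_edist_tendsto_0.1 (M.φ.hasSum_repr x).tendsto_sum_nat
  refine h.congr fun N => ?_
  rw [edist_eq_enorm_sub]
  refine (M.scaleNorm_eq_enorm fun k => ?_).symm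
  rw [coef_sub, Pi.sub_apply, Pi.sub_apply, mul_sub, hx]
  congr 1
  simp only [coef, inner_sum, inner_smul_right, HilbertBasis.repr_apply_apply,
    orthonormal_iff_ite.1 M.φ.orthonormal, Finset.sum_apply, Pi.smul_apply, Pi.single_apply]
  simp only [smul_eq_mul, mul_ite, mul_one, mul_zero, Finset.sum_ite_eq]
  split_ifs
  · exact hx k
  · rfl

lemma memScale_single (t : ℝ) (j : ℕ) : M.MemScale t (Pi.single j 1) := by
  refine M.memScale_of_vector (x := M.lam j ^ (-t) • M.φ j) fun k => ?_
  simp only [coef, inner_smul_right, orthonormal_iff_ite.1 M.φ.orthonormal, Pi.single_apply]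
  split_ifs with h <;> simp [h]

end InverseProblem

namespace InverseProblem

variable {X : Type*} [NormedAddCommGroup X] [InnerProductSpace ℝ X] [CompleteSpace X]
variable (M : InverseProblem X)

/-! ### The operators `A⁻¹` and `C₁^{-1/2} A⁻¹` -/

lemma inner_Ainv_left (x y : X) : ⟪M.Ainv x, y⟫_ℝ = ⟪x, M.Ainv y⟫_ℝ := by
  have h := LinearPMap.adjoint_isFormalAdjoint M.A_dense
  rw [LinearPMap.isSelfAdjoint_def.1 M.A_selfAdjoint] at h
  have := h ⟨M.Ainv x, M.Ainv_mem x⟩ ⟨M.Ainv y, M.Ainv_mem y⟩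
  rw [M.A_Ainv, M.A_Ainv] at this
  exact this.symm

lemma inner_sqrtC₁_left (x y : X) : ⟪M.sqrtC₁ x, y⟫_ℝ = ⟪x, M.sqrtC₁ y⟫_ℝ :=
  M.sqrtC₁_pos.isSymmetric x y

lemma sqrtC₁_sqrtC₁ (x : X) : M.sqrtC₁ (M.sqrtC₁ x) = M.C₁ x := by
  rw [← M.sqrtC₁_sq]; rfl

lemma inner_C₁_self (x : X) : ⟪M.C₁ x, x⟫_ℝ = ‖M.sqrtC₁ x‖ ^ 2 := by
  rw [← sqrtC₁_sqrtC₁, inner_sqrtC₁_left, real_inner_self_eq_norm_sq]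

lemma sqrtC₁_injective : Function.Injective M.sqrtC₁ := by
  refine (injective_iff_map_eq_zero M.sqrtC₁).2 fun x hx => ?_
  by_contra h
  have := M.C₁_posDef x h
  rw [inner_C₁_self, hx] at this
  simp at this

/-- The operator `C₁^{-1/2} A⁻¹`. -/
noncomputable def whitenedForward (v : X) : X := M.invSqrtC₁ (M.Ainv v)

lemma form_eq (Λ : ℝ) (w v : X) : M.form Λ w v =
    ⟪M.whitenedForward w, M.whitenedForward v⟫_ℝ
      + Λ * ∑' k, M.lam k ^ (-2 : ℝ) * (M.coef w k * M.coef v k) := rfl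

namespace Assumptions

variable {M} {s₀ β ℓ : ℝ} (hM : M.Assumptions s₀ β ℓ)
include hM

lemma delta_pos : 0 < 2 * ℓ - β + 1 := by linarith [hM.illposed, hM.s₀_nonneg]

lemma kappa_le_one : β - 2 * ℓ ≤ 1 := by linarith [hM.delta_pos]

lemma sqrtC₁_whitenedForward {v : X} (hv : M.MemScale (β - 2 * ℓ) (M.coef v)) :
    M.sqrtC₁ (M.whitenedForward v) = M.Ainv v := by
  obtain ⟨c, c', -, -, h⟩ := hM.forward
  exact Function.invFun_eq (h v hv).1

/-- `invSqrtC₁` is only a choice of preimages, so linearity has to be recovered from A⁻¹ through the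
injectivity of C₁^{1/2}, on vectors whose image under A⁻¹ lies in its range. -/
lemma whitenedForward_add {v w : X} (hv : M.MemScale (β - 2 * ℓ) (M.coef v))
    (hw : M.MemScale (β - 2 * ℓ) (M.coef w)) :
    M.whitenedForward (v + w) = M.whitenedForward v + M.whitenedForward w := by
  apply M.sqrtC₁_injective
  rw [map_add, hM.sqrtC₁_whitenedForward hv, hM.sqrtC₁_whitenedForward hw,
    hM.sqrtC₁_whitenedForward (by rw [coef_add]; exact hv.add hw), map_add]

lemma whitenedForward_smul (c : ℝ) {v : X} (hv : M.MemScale (β - 2 * ℓ) (M.coef v)) :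
    M.whitenedForward (c • v) = c • M.whitenedForward v := by
  apply M.sqrtC₁_injective
  rw [map_smul, hM.sqrtC₁_whitenedForward hv,
    hM.sqrtC₁_whitenedForward (by rw [coef_smul]; exact hv.smul c), map_smul]

end Assumptions

/-! ### The bilinear form -/

variable {M} in
lemma summable_form_term {w v : X} (hw : M.MemScale 1 (M.coef w)) (hv : M.MemScale 1 (M.coef v)) :
    Summable fun k => M.lam k ^ (-2 : ℝ) * (M.coef w k * M.coef v k) := by
  obtain ⟨x, hx⟩ := M.exists_vector_of_memScale hw
  obtain ⟨y, hy⟩ := M.exists_vector_of_memScale hv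
  refine (M.hasSum_coef_mul_coef x y).summable.congr fun k => ?_
  rw [hx, hy, show (-2 : ℝ) = -1 + -1 by norm_num, Real.rpow_add (M.lam_pos k)]
  ring

namespace Assumptions

variable {M} {s₀ β ℓ : ℝ} (hM : M.Assumptions s₀ β ℓ)
include hM

lemma form_add_left (Λ : ℝ) {w w' v : X} (hw : M.MemScale 1 (M.coef w))
    (hw' : M.MemScale 1 (M.coef w')) (hv : M.MemScale 1 (M.coef v)) :
    M.form Λ (w + w') v = M.form Λ w v + M.form Λ w' v := by
  have hκ := hM.kappa_le_one
  rw [form_eq, form_eq, form_eq, hM.whitenedForward_add (hw.mono hκ) (hw'.mono hκ), inner_add_left]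
  have h : (fun k => M.lam k ^ (-2 : ℝ) * (M.coef (w + w') k * M.coef v k)) =
      fun k => M.lam k ^ (-2 : ℝ) * (M.coef w k * M.coef v k)
        + M.lam k ^ (-2 : ℝ) * (M.coef w' k * M.coef v k) := by
    funext k; rw [coef_add, Pi.add_apply]; ring
  rw [h, (summable_form_term hw hv).tsum_add (summable_form_term hw' hv)]
  ring

lemma form_smul_left (Λ c : ℝ) {w : X} (v : X) (hw : M.MemScale 1 (M.coef w)) :
    M.form Λ (c • w) v = c * M.form Λ w v := by
  rw [form_eq, form_eq, hM.whitenedForward_smul c (hw.mono hM.kappa_le_one),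
    real_inner_smul_left]
  have h : (fun k => M.lam k ^ (-2 : ℝ) * (M.coef (c • w) k * M.coef v k)) =
      fun k => c * (M.lam k ^ (-2 : ℝ) * (M.coef w k * M.coef v k)) := by
    funext k; rw [coef_smul, Pi.smul_apply, smul_eq_mul]; ring
  rw [h, tsum_mul_left]
  ring

lemma form_sub_left (Λ : ℝ) {w w' v : X} (hw : M.MemScale 1 (M.coef w))
    (hw' : M.MemScale 1 (M.coef w')) (hv : M.MemScale 1 (M.coef v)) :
    M.form Λ (w - w') v = M.form Λ w v - M.form Λ w' v := by
  have h : w - w' = w + (-1 : ℝ) • w' := by simp [sub_eq_add_neg]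
  rw [h, hM.form_add_left Λ hw (by rw [coef_smul]; exact hw'.smul _) hv, hM.form_smul_left Λ _ v hw']
  ring

omit hM in
lemma form_self (Λ : ℝ) {w : X} (hw : M.MemScale 1 (M.coef w)) :
    M.form Λ w w = ‖M.whitenedForward w‖ ^ 2 + Λ * (M.scaleNorm 1 (M.coef w)).toReal ^ 2 := by
  have := (M.hasSum_sq_of_memScale hw).tsum_eq
  rw [mul_one] at this
  rw [form_eq, this, real_inner_self_eq_norm_sq]

/-! ### Existence of weak solutions -/

/-- Lax–Milgram, transported from X^1 to X by the isometry `D` = C₀^{1/2}. There the form becomes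
⟨Tx,Ty⟩ + Λ⟨x,y⟩ with T = C₁^{-1/2} A⁻¹ C₀^{1/2}, which is bounded because κ = β - 2ℓ ≤ 1, and
coercive with constant Λ. -/
lemma exists_isWeakSolution {Λ : ℝ} (hΛ : 0 < Λ) {r : ℕ → ℝ} (hr : M.MemScale (-1) r) :
    ∃ w, M.IsWeakSolution Λ r w := by
  have hκ := hM.kappa_le_one
  have hD : ∀ x : X, ∃ z : X, M.MemScale 1 (M.coef z) ∧
      ∀ k, M.coef x k = M.lam k ^ (-1 : ℝ) * M.coef z k := fun x => by
    obtain ⟨a, ha⟩ := M.exists_seq_of_vector 1 x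
    obtain ⟨z, hz⟩ := M.exists_vector_of_memScale
      ((M.memScale_of_vector ha).mono (zero_le_one (α := ℝ)))
    have hz' : M.coef z = a := by funext k; rw [hz]; simp
    exact ⟨z, hz' ▸ M.memScale_of_vector ha, hz' ▸ ha⟩
  choose D hD1 hD2 using hD
  have hDeq : ∀ {x z : X}, (∀ k, M.coef x k = M.lam k ^ (-1 : ℝ) * M.coef z k) → D x = z := by
    intro x z h
    apply M.coef_injective
    funext k
    exact mul_left_cancel₀ (M.lam_rpow_pos k (-1)).ne' ((hD2 x k).symm.trans (h k))
  have hDadd : ∀ x y, D (x + y) = D x + D y := fun x y => hDeq fun k => by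
    rw [coef_add, coef_add, Pi.add_apply, Pi.add_apply, hD2 x, hD2 y, mul_add]
  have hDsmul : ∀ (c : ℝ) x, D (c • x) = c • D x := fun c x => hDeq fun k => by
    rw [coef_smul, coef_smul, Pi.smul_apply, Pi.smul_apply, hD2, smul_eq_mul, smul_eq_mul]; ring
  obtain ⟨c, c', -, -, hfw⟩ := hM.forward
  obtain ⟨C, -, hC⟩ := M.exists_scaleNorm_le hκ
  let T₀ : X →ₗ[ℝ] X :=
    { toFun := fun x => M.whitenedForward (D x)
      map_add' := fun x y => by
        rw [hDadd, hM.whitenedForward_add ((hD1 x).mono hκ) ((hD1 y).mono hκ)]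
      map_smul' := fun a x => by
        rw [hDsmul, hM.whitenedForward_smul a ((hD1 x).mono hκ), RingHom.id_apply] }
  let T : X →L[ℝ] X := T₀.mkContinuous (c' * C) fun x => by
    have h1 := (hfw (D x) ((hD1 x).mono hκ)).2.2.trans (mul_le_mul_right (hC _) _)
    rw [M.scaleNorm_eq_enorm (hD2 x), ← mul_assoc] at h1
    have h2 := ENNReal.toReal_mono
      (ENNReal.mul_ne_top (ENNReal.mul_ne_top ENNReal.coe_ne_top ENNReal.coe_ne_top) enorm_ne_top) h1
    simpa [T₀, whitenedForward] using h2
  let B : X →L[ℝ] X →L[ℝ] ℝ := (innerSL ℝ).bilinearComp T T + Λ • innerSL ℝ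
  have hB : ∀ x y, B x y = ⟪T x, T y⟫_ℝ + Λ * ⟪x, y⟫_ℝ := fun x y => rfl
  have hcoer : IsCoercive B := ⟨Λ, hΛ, fun x => by
    rw [hB, real_inner_self_eq_norm_sq, real_inner_self_eq_norm_sq]
    nlinarith [sq_nonneg ‖T x‖]⟩
  -- `g` = C₀^{1/2} r is the Riesz representative of the functional r after the transport to X.
  obtain ⟨g, hg⟩ := M.exists_vector_of_memScale hr
  set x := hcoer.continuousLinearEquivOfBilin.symm g with hx
  refine ⟨D x, hr, hD1 x, fun v hv => ?_⟩
  obtain ⟨y, hy⟩ := M.exists_vector_of_memScale hv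
  have hDy : D y = v := hDeq hy
  have h1 : ⟪g, y⟫_ℝ = B x y := by
    rw [← hcoer.continuousLinearEquivOfBilin_apply, hx, ContinuousLinearEquiv.apply_symm_apply]
  have h2 : ∑' k, M.lam k ^ (-2 : ℝ) * (M.coef (D x) k * M.coef v k) = ⟪x, y⟫_ℝ := by
    rw [← (M.hasSum_coef_mul_coef x y).tsum_eq]
    refine tsum_congr fun k => ?_
    rw [hD2 x, hy, show (-2 : ℝ) = -1 + -1 by norm_num, Real.rpow_add (M.lam_pos k)]
    ring
  rw [(M.hasSum_mul_of_vector hg hy).tsum_eq, h1, hB, form_eq, h2, ← hDy]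
  rfl

/-! ### The extension of `A⁻¹ C₁⁻¹` -/

omit hM in
lemma _root_.InverseProblem.IsAinvC₁inv.add {y y' r r' : ℕ → ℝ} (h : M.IsAinvC₁inv β ℓ y r)
    (h' : M.IsAinvC₁inv β ℓ y' r') : M.IsAinvC₁inv β ℓ (y + y') (r + r') := by
  obtain ⟨hy, hr, x, h1, h2⟩ := h
  obtain ⟨hy', hr', x', h1', h2'⟩ := h'
  refine ⟨hy.add hy', hr.add hr', x + x', ?_, ?_⟩
  · refine tendsto_of_tendsto_of_tendsto_of_le_of_le tendsto_const_nhds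
      (by simpa using h1.add h1') (fun _ => zero_le) fun j => ?_
    rw [Pi.add_apply, map_add, coef_add, add_sub_add_comm]
    exact M.scaleNorm_add_le _ _ _
  · refine tendsto_of_tendsto_of_tendsto_of_le_of_le tendsto_const_nhds
      (by simpa using h2.add h2') (fun _ => zero_le) fun j => ?_
    rw [Pi.add_apply, map_add, coef_add, add_sub_add_comm]
    exact M.scaleNorm_add_le _ _ _

omit hM in
lemma _root_.InverseProblem.IsAinvC₁inv.smul (c : ℝ) {y r : ℕ → ℝ} (h : M.IsAinvC₁inv β ℓ y r) :
    M.IsAinvC₁inv β ℓ (c • y) (c • r) := by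
  obtain ⟨hy, hr, x, h1, h2⟩ := h
  have hlim : ∀ {f : ℕ → ℝ≥0∞}, Tendsto f atTop (𝓝 0) →
      Tendsto (fun j => ‖c‖ₑ * f j) atTop (𝓝 0) := fun hf => by
    simpa using ENNReal.Tendsto.const_mul hf (Or.inr enorm_ne_top)
  refine ⟨hy.smul c, hr.smul c, c • x, (hlim h1).congr fun j => ?_, (hlim h2).congr fun j => ?_⟩ <;>
  rw [Pi.smul_apply, map_smul, coef_smul, ← smul_sub, scaleNorm_smul]

lemma exists_scaleNorm_le_of_isAinvC₁inv : ∃ c : ℝ≥0, ∀ y r, M.IsAinvC₁inv β ℓ y r →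
    M.scaleNorm (-1) r ≤ c * M.scaleNorm (2 * β - 2 * ℓ - 1) y := by
  obtain ⟨c, -, hc⟩ := hM.data
  refine ⟨c, fun y r ⟨_, _, x, h1, h2⟩ => ?_⟩
  have hb := (hc 1 ⟨hM.kappa_le_one, le_rfl⟩).2
  have hlim : Tendsto (fun j => M.scaleNorm (-1) (M.coef (M.Ainv (x j)) - r)
      + c * (M.scaleNorm (2 * β - 2 * ℓ - 1) (M.coef (M.C₁ (x j)) - y)
        + M.scaleNorm (2 * β - 2 * ℓ - 1) y)) atTop
      (𝓝 (0 + c * (0 + M.scaleNorm (2 * β - 2 * ℓ - 1) y))) :=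
    h2.add (ENNReal.Tendsto.const_mul (h1.add tendsto_const_nhds) (Or.inr ENNReal.coe_ne_top))
  rw [zero_add, zero_add] at hlim
  refine ge_of_tendsto' hlim fun j => ?_
  calc M.scaleNorm (-1) r
      ≤ M.scaleNorm (-1) (r - M.coef (M.Ainv (x j))) + M.scaleNorm (-1) (M.coef (M.Ainv (x j))) := by
        simpa using M.scaleNorm_add_le (-1) (r - M.coef (M.Ainv (x j))) (M.coef (M.Ainv (x j)))
    _ ≤ _ := by
        rw [scaleNorm_sub_comm]
        gcongr
        refine (hb _).trans ?_
        gcongr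
        simpa using M.scaleNorm_add_le (2 * β - 2 * ℓ - 1) (M.coef (M.C₁ (x j)) - y) y

/-- The bound on A⁻¹C₁⁻¹ turns a convergent sequence C₁x_j into a Cauchy sequence A⁻¹x_j in X^{-1}.
Any approximating sequence may thus be used to define the extension. -/
lemma exists_isAinvC₁inv_of_tendsto {y : ℕ → ℝ} (hy : M.MemScale (2 * β - 2 * ℓ - 1) y) {x : ℕ → X}
    (hx : Tendsto (fun j => M.scaleNorm (2 * β - 2 * ℓ - 1) (M.coef (M.C₁ (x j)) - y)) atTop
      (𝓝 0)) :
    ∃ r, M.MemScale (-1) r ∧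
      Tendsto (fun j => M.scaleNorm (-1) (M.coef (M.Ainv (x j)) - r)) atTop (𝓝 0) := by
  obtain ⟨c, -, hc⟩ := hM.data
  have hb := (hc 1 ⟨hM.kappa_le_one, le_rfl⟩).2
  -- Finitely many C₁x_j may lie outside X^{2β-2ℓ-1}. The sequence is shifted past them so that all
  -- norms are finite.
  obtain ⟨N, hN⟩ := eventually_atTop.1 (hx.eventually_lt_const zero_lt_one)
  set z : ℕ → X := fun j => x (j + N)
  have hz := (tendsto_add_atTop_iff_nat N).2 hx
  have hmem : ∀ j, M.MemScale (-1) (M.coef (M.Ainv (z j))) := fun j => by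
    refine (hb _).trans_lt (ENNReal.mul_lt_top ENNReal.coe_lt_top ?_)
    have := M.scaleNorm_add_le (2 * β - 2 * ℓ - 1) (M.coef (M.C₁ (z j)) - y) y
    rw [sub_add_cancel] at this
    exact this.trans_lt (ENNReal.add_lt_top.2 ⟨(hN _ (Nat.le_add_left _ _)).trans (by simp), hy⟩)
  obtain ⟨r, hr, hlim⟩ := M.exists_tendsto_of_cauchy hmem
    (b := fun j => c * M.scaleNorm (2 * β - 2 * ℓ - 1) (M.coef (M.C₁ (z j)) - y))
    (by simpa using ENNReal.Tendsto.const_mul hz (Or.inr ENNReal.coe_ne_top)) (fun i j => by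
      rw [← coef_sub, ← map_sub, ← mul_add]
      refine (hb _).trans ?_
      gcongr
      rw [map_sub, coef_sub, M.scaleNorm_sub_comm _ (M.coef (M.C₁ (z j)))]
      exact M.scaleNorm_sub_le _ _ _ _)
  exact ⟨r, hr, (tendsto_add_atTop_iff_nat N).1 hlim⟩

lemma exists_tendsto_C₁ {η : ℝ} (hη : η ∈ Icc (β - 2 * ℓ) 1) {y : ℕ → ℝ}
    (hy : M.MemScale (2 * β - 2 * ℓ - η) y) : ∃ x : ℕ → X,
    Tendsto (fun j => M.scaleNorm (2 * β - 2 * ℓ - η) (M.coef (M.C₁ (x j)) - y)) atTop (𝓝 0) := by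
  obtain ⟨c, -, hc⟩ := hM.data
  choose x hx using fun j : ℕ => (hc η hη).1 y hy ((j : ℝ≥0∞) + 1)⁻¹
    (ENNReal.inv_pos.2 (by finiteness))
  refine ⟨x, tendsto_of_tendsto_of_tendsto_of_le_of_le tendsto_const_nhds ?_ (fun _ => zero_le)
    fun j => (hx j).le⟩
  have := (tendsto_add_atTop_iff_nat 1).2 ENNReal.tendsto_inv_nat_nhds_zero
  simpa using this

/-! ### The posterior mean as a function of the data -/

lemma exists_isPosteriorMean {Λ : ℝ} (hΛ : 0 < Λ) {y : ℕ → ℝ}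
    (hy : M.MemScale (2 * β - 2 * ℓ - 1) y) : ∃ w, M.IsPosteriorMean β ℓ Λ y w := by
  obtain ⟨x, hx⟩ := hM.exists_tendsto_C₁ ⟨hM.kappa_le_one, le_rfl⟩ hy
  obtain ⟨r, hr, hlim⟩ := hM.exists_isAinvC₁inv_of_tendsto hy hx
  obtain ⟨w, hw⟩ := hM.exists_isWeakSolution hΛ hr
  exact ⟨w, r, ⟨hy, hr, x, hx, hlim⟩, hw⟩

lemma isPosteriorMean_add {Λ : ℝ} {y y' : ℕ → ℝ} {w w' : X} (h : M.IsPosteriorMean β ℓ Λ y w)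
    (h' : M.IsPosteriorMean β ℓ Λ y' w') : M.IsPosteriorMean β ℓ Λ (y + y') (w + w') := by
  obtain ⟨r, hr, h1, h2, h3⟩ := h
  obtain ⟨r', hr', h1', h2', h3'⟩ := h'
  refine ⟨r + r', hr.add hr', h1.add h1', by rw [coef_add]; exact h2.add h2', fun v hv => ?_⟩
  rw [hM.form_add_left Λ h2 h2' hv, h3 v hv, h3' v hv,
    ← (M.summable_mul h1 hv).tsum_add (M.summable_mul h1' hv)]
  simp only [Pi.add_apply, add_mul]

lemma isPosteriorMean_smul {Λ : ℝ} (c : ℝ) {y : ℕ → ℝ} {w : X} (h : M.IsPosteriorMean β ℓ Λ y w) :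
    M.IsPosteriorMean β ℓ Λ (c • y) (c • w) := by
  obtain ⟨r, hr, h1, h2, h3⟩ := h
  refine ⟨c • r, hr.smul c, h1.smul c, by rw [coef_smul]; exact h2.smul c, fun v hv => ?_⟩
  rw [hM.form_smul_left Λ c v h2, h3 v hv, ← tsum_mul_left]
  simp only [Pi.smul_apply, smul_eq_mul, mul_assoc]

lemma isPosteriorMean_sub {Λ : ℝ} {y y' : ℕ → ℝ} {w w' : X} (h : M.IsPosteriorMean β ℓ Λ y w)
    (h' : M.IsPosteriorMean β ℓ Λ y' w') : M.IsPosteriorMean β ℓ Λ (y - y') (w - w') := by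
  simpa [sub_eq_add_neg] using hM.isPosteriorMean_add h (hM.isPosteriorMean_smul (-1) h')

/-- Testing with w itself gives Λ‖w‖₁² ≤ ‖r‖_{-1}‖w‖₁, and ‖r‖_{-1} is controlled by the data.
Applied to differences, this yields both uniqueness and continuity in the data. -/
lemma exists_enorm_le_of_isPosteriorMean {Λ : ℝ} (hΛ : 0 < Λ) : ∃ C : ℝ≥0, ∀ y w,
    M.IsPosteriorMean β ℓ Λ y w → ‖w‖ₑ ≤ C * M.scaleNorm (2 * β - 2 * ℓ - 1) y := by
  obtain ⟨c, hc⟩ := hM.exists_scaleNorm_le_of_isAinvC₁inv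
  obtain ⟨C, -, hC⟩ := M.exists_scaleNorm_le (zero_le_one (α := ℝ))
  refine ⟨C * (Λ⁻¹.toNNReal * c), fun y w ⟨r, hr, h1, h2, h3⟩ => ?_⟩
  have h4 := h3 w h2
  rw [form_self Λ h2] at h4
  have h5 := (le_abs_self _).trans (M.abs_tsum_mul_le h1 h2)
  rw [← h4] at h5
  set p := (M.scaleNorm 1 (M.coef w)).toReal with hp
  set q := (M.scaleNorm (-1) r).toReal with hq
  have hp0 : 0 ≤ p := ENNReal.toReal_nonneg
  have hq0 : 0 ≤ q := ENNReal.toReal_nonneg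
  have h6 : p ≤ Λ⁻¹ * q := by
    rw [inv_mul_eq_div, le_div_iff₀ hΛ]
    rcases hp0.eq_or_lt with h | h
    · rw [← h]; simpa using hq0
    · nlinarith [sq_nonneg ‖M.whitenedForward w‖]
  have h7 : M.scaleNorm 1 (M.coef w) ≤ Λ⁻¹.toNNReal * M.scaleNorm (-1) r := by
    rw [← ENNReal.ofReal_toReal h1.ne, ← ENNReal.ofReal_toReal h2.ne]
    refine (ENNReal.ofReal_le_ofReal h6).trans ?_
    rw [ENNReal.ofReal_mul (by positivity)]
    rfl
  rw [← scaleNorm_zero_coef]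
  refine (hC _).trans ?_
  push_cast
  rw [mul_assoc, mul_assoc]
  gcongr
  refine h7.trans ?_
  gcongr
  exact hc y r hr

lemma isPosteriorMean_unique {Λ : ℝ} (hΛ : 0 < Λ) {y : ℕ → ℝ} {w w' : X}
    (h : M.IsPosteriorMean β ℓ Λ y w) (h' : M.IsPosteriorMean β ℓ Λ y w') : w = w' := by
  obtain ⟨C, hC⟩ := hM.exists_enorm_le_of_isPosteriorMean hΛ
  have := hC _ _ (hM.isPosteriorMean_sub h h')
  rw [sub_self] at this
  have h0 : M.scaleNorm (2 * β - 2 * ℓ - 1) 0 = 0 := by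
    have := M.scaleNorm_smul (2 * β - 2 * ℓ - 1) 0 0
    simpa using this
  rw [h0, mul_zero, nonpos_iff_eq_zero, enorm_eq_zero] at this
  exact sub_eq_zero.1 this

lemma isPosteriorMean_posteriorMean {Λ : ℝ} (hΛ : 0 < Λ) {y : ℕ → ℝ}
    (hy : M.MemScale (2 * β - 2 * ℓ - 1) y) :
    M.IsPosteriorMean β ℓ Λ y (M.posteriorMean β ℓ Λ y) :=
  Classical.epsilon_spec (hM.exists_isPosteriorMean hΛ hy)

lemma isPosteriorMean_sum {Λ : ℝ} {ι : Type*} (s : Finset ι) {y : ι → ℕ → ℝ} {w : ι → X}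
    (h0 : M.IsPosteriorMean β ℓ Λ 0 0) (h : ∀ i, M.IsPosteriorMean β ℓ Λ (y i) (w i)) :
    M.IsPosteriorMean β ℓ Λ (∑ i ∈ s, y i) (∑ i ∈ s, w i) := by
  classical
  induction s using Finset.induction_on with
  | empty => simpa using h0
  | insert i s hi ih =>
    rw [Finset.sum_insert hi, Finset.sum_insert hi]
    exact hM.isPosteriorMean_add (h i) ih

/-- The posterior mean is the limit of the posterior means for the truncated data. -/
lemma tendsto_posteriorMean_truncation {Λ : ℝ} (hΛ : 0 < Λ) {y : ℕ → ℝ}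
    (hy : M.MemScale (2 * β - 2 * ℓ - 1) y) :
    Tendsto (fun N => ∑ j ∈ Finset.range N, y j • M.posteriorMean β ℓ Λ (Pi.single j 1)) atTop
      (𝓝 (M.posteriorMean β ℓ Λ y)) := by
  obtain ⟨C, hC⟩ := hM.exists_enorm_le_of_isPosteriorMean hΛ
  have hw := hM.isPosteriorMean_posteriorMean hΛ hy
  have h0 : M.IsPosteriorMean β ℓ Λ 0 0 := by simpa using hM.isPosteriorMean_smul 0 hw
  rw [tendsto_iff_edist_tendsto_0]
  have hlim := ENNReal.Tendsto.const_mul (a := (C : ℝ≥0∞)) (M.tendsto_truncation hy)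
    (Or.inr ENNReal.coe_ne_top)
  rw [mul_zero] at hlim
  refine tendsto_of_tendsto_of_tendsto_of_le_of_le tendsto_const_nhds hlim (fun _ => zero_le)
    fun N => ?_
  rw [edist_eq_enorm_sub]
  exact hC _ _ (hM.isPosteriorMean_sub (hM.isPosteriorMean_sum _ h0 fun j =>
    hM.isPosteriorMean_smul (y j) (hM.isPosteriorMean_posteriorMean hΛ (M.memScale_single _ j))) hw)

end Assumptions

end InverseProblem

namespace InverseProblem

variable {X : Type*} [NormedAddCommGroup X] [InnerProductSpace ℝ X] [CompleteSpace X]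
variable (M : InverseProblem X)

/-! ### Second moments of the noise -/

lemma scaleNorm_basis_sq (t : ℝ) (j : ℕ) :
    M.scaleNorm t (M.coef (M.φ j)) ^ 2 = ENNReal.ofReal (M.lam j ^ (-2 * t)) := by
  have h : ∀ k, M.coef (M.lam j ^ (-t) • M.φ j) k = M.lam k ^ (-t) * M.coef (M.φ j) k := fun k => by
    simp only [coef, inner_smul_right, orthonormal_iff_ite.1 M.φ.orthonormal]
    split_ifs with h <;> simp [h]
  have h2 := M.weight_eq_sq j t 1
  rw [one_pow, mul_one, mul_one] at h2
  rw [M.scaleNorm_eq_enorm h, ← ofReal_norm, norm_smul, M.φ.orthonormal.1 j, mul_one,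
    ← ENNReal.ofReal_pow (norm_nonneg _), Real.norm_eq_abs, sq_abs, h2]

variable {M} {Ω : Type*} [MeasurableSpace Ω] {P : Measure Ω} {ξ : Ω → ℕ → ℝ}

lemma IsNoise.hasLaw (hξ : M.IsNoise P ξ) (k : ℕ) :
    HasLaw (fun ω => ξ ω k) (gaussianReal 0 (‖M.sqrtC₁ (M.φ k)‖ ^ 2).toNNReal) P := by
  have h := hξ (Finsupp.single k 1)
  simpa [inner_C₁_self] using h

lemma IsNoise.lintegral_sq (hξ : M.IsNoise P ξ) (k : ℕ) :
    ∫⁻ ω, ENNReal.ofReal (ξ ω k ^ 2) ∂P = ENNReal.ofReal (‖M.sqrtC₁ (M.φ k)‖ ^ 2) := by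
  rw [(hξ.hasLaw k).lintegral_comp (f := fun x => ENNReal.ofReal (x ^ 2)) (by fun_prop)]
  set v := (‖M.sqrtC₁ (M.φ k)‖ ^ 2).toNNReal
  have h1 := variance_id_gaussianReal (μ := 0) (v := v)
  have hL : MemLp id 2 (gaussianReal 0 v) := memLp_id_gaussianReal 2
  rw [variance_eq_sub hL] at h1
  simp only [id, integral_id_gaussianReal, Pi.pow_apply] at h1
  have hI : Integrable (fun x : ℝ => x ^ 2) (gaussianReal 0 v) := hL.integrable_sq
  rw [← ofReal_integral_eq_lintegral_ofReal hI (ae_of_all _ fun x => sq_nonneg x)]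
  change ENNReal.ofReal (∫ x, x ^ 2 ∂gaussianReal 0 v) = (v : ℝ≥0∞)
  rw [show ∫ x, x ^ 2 ∂gaussianReal 0 v = v by linarith, ENNReal.ofReal_coe_nnreal]

lemma IsNoise.aemeasurable_scaleNorm_sq (hξ : M.IsNoise P ξ) (t : ℝ) :
    AEMeasurable (fun ω => M.scaleNorm t (ξ ω) ^ 2) P := by
  simp only [scaleNorm_sq]
  refine AEMeasurable.tsum fun k => ?_
  exact (((hξ.hasLaw k).aemeasurable.pow_const 2).const_mul _).ennreal_ofReal

namespace Assumptions

variable {s₀ β ℓ : ℝ} (hM : M.Assumptions s₀ β ℓ)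
include hM

/-- The second moment is a squared Hilbert–Schmidt norm: self-adjointness of C₁^{1/2} and an
exchange of sums turn it into ∑_j ‖C₁^{1/2}φ_j‖²_{β-s}. By the noise assumption with ρ = β - s this
is at most a multiple of ∑_j ‖φ_j‖²_{-s}, the trace of C₀^s. Only the variances of the coordinates
of ξ enter. -/
lemma lintegral_scaleNorm_noise_lt_top (hξ : M.IsNoise P ξ) {s : ℝ} (hs : s₀ < s)
    (hs' : (⌈β - s₀ - 1⌉ : ℝ) ≤ β - s) : ∫⁻ ω, M.scaleNorm (β - s) (ξ ω) ^ 2 ∂P < ∞ := by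
  obtain ⟨c, -, hc⟩ := hM.noise
  have hb := (hc (β - s) ⟨hs', by linarith⟩).2
  rw [sub_sub_cancel_left] at hb
  have h1 : ∫⁻ ω, M.scaleNorm (β - s) (ξ ω) ^ 2 ∂P =
      ∑' k, ENNReal.ofReal (M.lam k ^ (-2 * (β - s))) *
        ENNReal.ofReal (‖M.sqrtC₁ (M.φ k)‖ ^ 2) := by
    simp only [scaleNorm_sq]
    rw [lintegral_tsum fun k => (((hξ.hasLaw k).aemeasurable.pow_const 2).const_mul _).ennreal_ofReal]
    refine tsum_congr fun k => ?_
    rw [← hξ.lintegral_sq k, ← lintegral_const_mul' _ _ ENNReal.ofReal_ne_top]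
    simp only [ENNReal.ofReal_mul (M.lam_rpow_pos k _).le]
  have h2 : ∀ k, ENNReal.ofReal (‖M.sqrtC₁ (M.φ k)‖ ^ 2) =
      ∑' j, ENNReal.ofReal (M.coef (M.sqrtC₁ (M.φ j)) k ^ 2) := fun k => by
    rw [ENNReal.ofReal_pow (norm_nonneg _), ofReal_norm, ← scaleNorm_zero_coef, scaleNorm_sq]
    refine tsum_congr fun j => ?_
    rw [mul_zero, Real.rpow_zero, one_mul, coef, coef, ← inner_sqrtC₁_left, real_inner_comm]
  have h3 : ∑' k, ENNReal.ofReal (M.lam k ^ (-2 * (β - s))) *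
        ENNReal.ofReal (‖M.sqrtC₁ (M.φ k)‖ ^ 2) =
      ∑' j, M.scaleNorm (β - s) (M.coef (M.sqrtC₁ (M.φ j))) ^ 2 := by
    simp only [h2, ← ENNReal.tsum_mul_left, scaleNorm_sq]
    rw [ENNReal.tsum_comm]
    simp only [ENNReal.ofReal_mul (M.lam_rpow_pos _ _).le]
  rw [h1, h3]
  calc ∑' j, M.scaleNorm (β - s) (M.coef (M.sqrtC₁ (M.φ j))) ^ 2
      ≤ ∑' j, (c : ℝ≥0∞) ^ 2 * ENNReal.ofReal (M.lam j ^ (2 * s)) := by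
        refine ENNReal.tsum_le_tsum fun j => ?_
        refine (pow_le_pow_left' (hb (M.φ j)) 2).trans (le_of_eq ?_)
        rw [mul_pow, ContinuousLinearMap.id_apply, scaleNorm_basis_sq, neg_mul_neg]
    _ < ∞ := by
        rw [ENNReal.tsum_mul_left]
        exact ENNReal.mul_lt_top (by finiteness) (hM.trace s hs).tsum_ofReal_lt_top

/-! ### The error equation -/

omit hM in
lemma _root_.InverseProblem.ofReal_abs_tsum_mul_le {t : ℝ} {a b : ℕ → ℝ} (ha : M.MemScale (-t) a)
    (hb : M.MemScale t b) :
    ENNReal.ofReal |∑' k, a k * b k| ≤ M.scaleNorm (-t) a * M.scaleNorm t b := by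
  refine (ENNReal.ofReal_le_ofReal (M.abs_tsum_mul_le ha hb)).trans (le_of_eq ?_)
  rw [ENNReal.ofReal_mul ENNReal.toReal_nonneg, ENNReal.ofReal_toReal ha.ne,
    ENNReal.ofReal_toReal hb.ne]

/-- A⁻¹u = C₁^{1/2}(Ku) with Ku ∈ X ⊂ X^{-s}, and C₁^{1/2} maps X^{-s} to X^{β-s}. -/
lemma memScale_Ainv {s : ℝ} (hs : s₀ < s) (hs' : (⌈β - s₀ - 1⌉ : ℝ) ≤ β - s) {u : X}
    (hu : M.MemScale 1 (M.coef u)) : M.MemScale (β - s) (M.coef (M.Ainv u)) := by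
  obtain ⟨c, -, hc⟩ := hM.noise
  have hb := (hc (β - s) ⟨hs', by linarith⟩).2 (M.whitenedForward u)
  rw [hM.sqrtC₁_whitenedForward (hu.mono hM.kappa_le_one)] at hb
  refine hb.trans_lt (ENNReal.mul_lt_top ENNReal.coe_lt_top ?_)
  exact (M.memScale_zero_coef _).mono (by linarith [hM.s₀_nonneg])

/-- The functional `⟨A⁻¹ C₁⁻¹ y, ·⟩` for the data `y = A⁻¹ u + z` differs from that for the exact
data by at most a multiple of `‖z‖_{β-s}`. -/
lemma exists_abs_form_sub_le {s : ℝ} (hs : s ∈ Ioc s₀ 1) (hsΔ : s ≤ 2 * ℓ - β + 1)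
    (hs' : (⌈β - s₀ - 1⌉ : ℝ) ≤ β - s) : ∃ C : ℝ≥0, ∀ {Λ : ℝ}, 0 < Λ → ∀ {u v w : X} {z : ℕ → ℝ},
      M.MemScale 1 (M.coef u) → M.MemScale 1 (M.coef v) → M.MemScale (β - s) z →
      M.IsPosteriorMean β ℓ Λ (M.coef (M.Ainv u) + z) w →
      ENNReal.ofReal |M.form Λ w v - ⟪M.whitenedForward u, M.whitenedForward v⟫_ℝ| ≤
        C * M.scaleNorm (β - s) z * M.scaleNorm (s + β - 2 * ℓ) (M.coef v) := by
  obtain ⟨c₂, -, hc₂⟩ := hM.noise_inv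
  obtain ⟨c₃, -, hc₃⟩ := hM.forward_reg
  refine ⟨c₂ * c₃, fun {Λ} hΛ {u v w z} hu hv hz hw => ?_⟩
  have hκ := hM.kappa_le_one
  have hs0 := hM.s₀_nonneg.trans_lt hs.1
  set y := M.coef (M.Ainv u) + z with hy
  have hys : M.MemScale (β - s) y := (hM.memScale_Ainv hs.1 hs' hu).add hz
  -- The sequence contained in `hw` approximates y only in the weaker norm of X^{2β-2ℓ-1}. Taking η
  -- = s + β - 2ℓ in the data assumption gives one that converges in X^{β-s}; uniqueness then shows
  -- that it leads to the same w.
  obtain ⟨x, hx⟩ := hM.exists_tendsto_C₁ (η := s + β - 2 * ℓ) ⟨by linarith, by linarith⟩ (y := y)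
    (by convert hys using 1; ring)
  rw [show 2 * β - 2 * ℓ - (s + β - 2 * ℓ) = β - s by ring] at hx
  have hle : 2 * β - 2 * ℓ - 1 ≤ β - s := by linarith
  have hx' : Tendsto (fun j => M.scaleNorm (2 * β - 2 * ℓ - 1) (M.coef (M.C₁ (x j)) - y)) atTop
      (𝓝 0) := by
    obtain ⟨C, -, hC⟩ := M.exists_scaleNorm_le hle
    refine tendsto_of_tendsto_of_tendsto_of_le_of_le tendsto_const_nhds ?_ (fun _ => zero_le)
      fun j => hC _
    simpa using ENNReal.Tendsto.const_mul hx (Or.inr ENNReal.coe_ne_top)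
  obtain ⟨r, hr, hlim⟩ := hM.exists_isAinvC₁inv_of_tendsto (hys.mono hle) hx'
  obtain ⟨w', hw'⟩ := hM.exists_isWeakSolution hΛ hr
  obtain rfl : w = w' := hM.isPosteriorMean_unique hΛ hw ⟨r, ⟨hys.mono hle, hr, x, hx', hlim⟩, hw'⟩
  rw [hw'.2.2 v hv]
  have hKv := hc₃ s hs v (hv.mono (by linarith))
  have hKvm : M.MemScale s (M.coef (M.whitenedForward v)) :=
    hKv.2.trans_lt (ENNReal.mul_lt_top ENNReal.coe_lt_top (hv.mono (by linarith)))
  have hbound : ∀ j,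
      ENNReal.ofReal |(∑' k, r k * M.coef v k) - ⟪M.whitenedForward u, M.whitenedForward v⟫_ℝ| ≤
        M.scaleNorm (-1) (M.coef (M.Ainv (x j)) - r) * M.scaleNorm 1 (M.coef v) +
        c₂ * (M.scaleNorm (β - s) (M.coef (M.C₁ (x j)) - y) + M.scaleNorm (β - s) z) *
          (c₃ * M.scaleNorm (s + β - 2 * ℓ) (M.coef v)) := fun j => by
    have hA : M.MemScale (-1) (M.coef (M.Ainv (x j))) := (M.memScale_zero_coef _).mono (by norm_num)
    have e1 : ∑' k, (M.coef (M.Ainv (x j)) - r) k * M.coef v k =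
        ⟪M.Ainv (x j), v⟫_ℝ - ∑' k, r k * M.coef v k := by
      rw [← (M.hasSum_coef_mul_coef _ v).tsum_eq,
        ← (M.summable_mul hA hv).tsum_sub (M.summable_mul hr hv)]
      simp only [Pi.sub_apply, sub_mul]
    -- Moving A⁻¹ to v and splitting off C₁^{1/2} gives ⟨A⁻¹x_j,v⟩ = ⟨C₁^{1/2}x_j,Kv⟩. The
    -- difference C₁^{1/2}x_j - Ku is C₁^{-1/2}(C₁x_j - A⁻¹u), whose argument tends to z in X^{β-s}.
    have e2 : ∑' k, M.coef (M.sqrtC₁ (x j) - M.whitenedForward u) k *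
        M.coef (M.whitenedForward v) k =
        ⟪M.Ainv (x j), v⟫_ℝ - ⟪M.whitenedForward u, M.whitenedForward v⟫_ℝ := by
      rw [(M.hasSum_coef_mul_coef _ _).tsum_eq, inner_sub_left, inner_sqrtC₁_left,
        hM.sqrtC₁_whitenedForward (hv.mono hκ), inner_Ainv_left]
    have b1 := M.ofReal_abs_tsum_mul_le (hA.sub hr) hv
    have b2 := M.ofReal_abs_tsum_mul_le (t := s)
      (a := M.coef (M.sqrtC₁ (x j) - M.whitenedForward u))
      ((M.memScale_zero_coef _).mono (by linarith)) hKvm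
    have b3 := (hc₂ s hs).2 (M.sqrtC₁ (x j) - M.whitenedForward u)
    rw [ContinuousLinearMap.id_apply, map_sub, sqrtC₁_sqrtC₁,
      hM.sqrtC₁_whitenedForward (hu.mono hκ), coef_sub M (M.C₁ (x j))] at b3
    have b4 : M.scaleNorm (β - s) (M.coef (M.C₁ (x j)) - M.coef (M.Ainv u)) ≤
        M.scaleNorm (β - s) (M.coef (M.C₁ (x j)) - y) + M.scaleNorm (β - s) z := by
      have := M.scaleNorm_add_le (β - s) (M.coef (M.C₁ (x j)) - y) z
      rwa [hy, sub_add_eq_sub_sub, sub_add_cancel, ← sub_add_eq_sub_sub, ← hy] at this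
    rw [e1] at b1
    rw [e2] at b2
    calc _ ≤ ENNReal.ofReal (|⟪M.Ainv (x j), v⟫_ℝ - ∑' k, r k * M.coef v k| +
          |⟪M.Ainv (x j), v⟫_ℝ - ⟪M.whitenedForward u, M.whitenedForward v⟫_ℝ|) := by
          refine ENNReal.ofReal_le_ofReal ?_
          rw [abs_sub_comm (⟪M.Ainv (x j), v⟫_ℝ) (∑' k, r k * M.coef v k)]
          exact abs_sub_le _ _ _
      _ ≤ _ := by
          rw [ENNReal.ofReal_add (abs_nonneg _) (abs_nonneg _)]
          refine add_le_add b1 (b2.trans (mul_le_mul' (b3.trans ?_) hKv.2))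
          gcongr
  have hv1 : M.scaleNorm 1 (M.coef v) ≠ ∞ := hv.ne
  have hv2 : M.scaleNorm (s + β - 2 * ℓ) (M.coef v) ≠ ∞ := (hv.mono (by linarith)).ne
  have hlim2 := (ENNReal.Tendsto.mul_const hlim (Or.inr hv1)).add
    (ENNReal.Tendsto.mul_const (ENNReal.Tendsto.const_mul (a := (c₂ : ℝ≥0∞))
      (hx.add (tendsto_const_nhds (x := M.scaleNorm (β - s) z))) (Or.inr ENNReal.coe_ne_top))
      (Or.inr (ENNReal.mul_ne_top (ENNReal.coe_ne_top (r := c₃)) hv2)))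
  refine (ge_of_tendsto' hlim2 hbound).trans (le_of_eq ?_)
  push_cast
  ring

omit hM in
-- The weight λ_k^{-2} carries X^γ isometrically to X^{γ-2}, the dual of X^{2-γ}.
lemma _root_.InverseProblem.abs_tsum_weight_mul_le {γ : ℝ} {a b : ℕ → ℝ} (ha : M.MemScale γ a)
    (hb : M.MemScale (2 - γ) b) : |∑' k, M.lam k ^ (-2 : ℝ) * (a k * b k)| ≤
      (M.scaleNorm γ a).toReal * (M.scaleNorm (2 - γ) b).toReal := by
  obtain ⟨x, hx⟩ := M.exists_vector_of_memScale ha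
  have hx' : ∀ k, M.coef x k = M.lam k ^ (-(-(2 - γ))) * (M.lam k ^ (-2 : ℝ) * a k) := fun k => by
    rw [hx, ← mul_assoc, ← Real.rpow_add (M.lam_pos k)]
    congr 2; ring
  have := M.abs_tsum_mul_le (M.memScale_of_vector hx') hb
  rw [M.scaleNorm_eq_enorm hx', ← M.scaleNorm_eq_enorm hx] at this
  simpa only [mul_assoc] using this

omit hM in
/-- Interpolation between `‖·‖_κ` and `Λ^{1/2} ‖·‖_1`. -/
lemma _root_.InverseProblem.toReal_scaleNorm_le {κ Λ N a : ℝ} (hΛ : 0 < Λ) (hN : 0 ≤ N) {e : ℕ → ℝ}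
    (hκ : κ ≤ 1) (he : M.MemScale 1 e) (h1 : (M.scaleNorm κ e).toReal ≤ N)
    (h2 : Λ ^ (1 / 2 : ℝ) * (M.scaleNorm 1 e).toReal ≤ N) (ha0 : 0 ≤ a) (ha1 : a ≤ 1) :
    (M.scaleNorm ((1 - a) * κ + a) e).toReal ≤ Λ ^ (-(a / 2)) * N := by
  have h := M.scaleNorm_interpolation κ 1 ha0 ha1 e
  rw [mul_one] at h
  have h3 := ENNReal.toReal_mono (ENNReal.mul_ne_top
    (ENNReal.rpow_ne_top_of_nonneg (sub_nonneg.2 ha1) (he.mono hκ).ne)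
    (ENNReal.rpow_ne_top_of_nonneg ha0 he.ne)) h
  rw [ENNReal.toReal_mul, ← ENNReal.toReal_rpow, ← ENNReal.toReal_rpow] at h3
  have h4 : (M.scaleNorm 1 e).toReal ≤ Λ ^ (-(1 / 2) : ℝ) * N := by
    rw [Real.rpow_neg hΛ.le, inv_mul_eq_div, le_div_iff₀ (Real.rpow_pos_of_pos hΛ _), mul_comm]
    exact h2
  calc _ ≤ _ := h3
    _ ≤ N ^ (1 - a) * (Λ ^ (-(1 / 2) : ℝ) * N) ^ a := by
        gcongr
    _ = Λ ^ (-(a / 2)) * N := by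
        rw [Real.mul_rpow (Real.rpow_pos_of_pos hΛ _).le hN, ← Real.rpow_mul hΛ.le, mul_left_comm,
          ← Real.rpow_add_of_nonneg hN (sub_nonneg.2 ha1) ha0]
        rw [show 1 - a + a = 1 by ring, Real.rpow_one]
        congr 2; ring

/-- The deterministic error estimate for the data `A⁻¹ u + z`. -/
lemma exists_error_le {s γ : ℝ} (hs : s ∈ Ioc s₀ 1) (hsΔ : s ≤ 2 * ℓ - β + 1)
    (hs' : (⌈β - s₀ - 1⌉ : ℝ) ≤ β - s) (hγ1 : 1 ≤ γ) (hγ2 : γ ≤ 2 * ℓ - β + 1 + 1) {u : X}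
    (hu : M.MemScale γ (M.coef u)) : ∃ C : ℝ, 0 < C ∧ ∀ {Λ θ : ℝ}, 0 < Λ → 0 ≤ θ → θ ≤ 1 →
      ∀ {w : X} {z : ℕ → ℝ}, M.MemScale (β - s) z →
      M.IsPosteriorMean β ℓ Λ (M.coef (M.Ainv u) + z) w →
      M.MemScale 1 (M.coef (w - u)) ∧
      (M.scaleNorm ((1 - θ) * (β - 2 * ℓ) + θ) (M.coef (w - u))).toReal ≤
        C * Λ ^ (-(θ / 2)) *
          (Λ ^ (1 - (2 * ℓ - β + 1 + 1 - γ) / (2 * ℓ - β + 1) / 2) +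
            Λ ^ (-(s / (2 * ℓ - β + 1) / 2)) * (M.scaleNorm (β - s) z).toReal) := by
  obtain ⟨C, hC⟩ := hM.exists_abs_form_sub_le hs hsΔ hs'
  obtain ⟨c, c', hc, -, hfw⟩ := hM.forward
  have hΔ := hM.delta_pos
  have hκ := hM.kappa_le_one
  have hu1 : M.MemScale 1 (M.coef u) := hu.mono hγ1
  set Δ := 2 * ℓ - β + 1 with hΔdef
  set U := (M.scaleNorm γ (M.coef u)).toReal with hU
  have hU0 : 0 ≤ U := ENNReal.toReal_nonneg
  -- With c the lower constant of the forward assumption, m N² ≤ B(e,e).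
  set m := min ((c : ℝ) ^ 2) 1 with hm
  have hm0 : 0 < m := lt_min (by positivity) one_pos
  refine ⟨m⁻¹ * (C + U + 1), by positivity, fun {Λ θ} hΛ hθ0 hθ1 {w z} hz hw => ?_⟩
  have hw1 : M.MemScale 1 (M.coef w) := hw.choose_spec.2.2.1
  set e := w - u with he
  have he1 : M.MemScale 1 (M.coef e) := by rw [he, coef_sub]; exact hw1.sub hu1
  refine ⟨he1, ?_⟩
  set Eκ := (M.scaleNorm (β - 2 * ℓ) (M.coef e)).toReal with hEκ
  set E1 := (M.scaleNorm 1 (M.coef e)).toReal with hE1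
  have hEκ0 : 0 ≤ Eκ := ENNReal.toReal_nonneg
  have hE10 : 0 ≤ E1 := ENNReal.toReal_nonneg
  set N := √(Eκ ^ 2 + Λ * E1 ^ 2) with hN
  have hN0 : 0 ≤ N := Real.sqrt_nonneg _
  have hNsq : N ^ 2 = Eκ ^ 2 + Λ * E1 ^ 2 := Real.sq_sqrt (by positivity)
  have hN1 : Eκ ≤ N := Real.le_sqrt_of_sq_le (by nlinarith [mul_nonneg hΛ.le (sq_nonneg E1)])
  have hN2 : Λ ^ (1 / 2 : ℝ) * E1 ≤ N := by
    refine Real.le_sqrt_of_sq_le ?_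
    rw [mul_pow, ← Real.sqrt_eq_rpow, Real.sq_sqrt hΛ.le]
    nlinarith [sq_nonneg Eκ]
  have hint : ∀ {a : ℝ}, 0 ≤ a → a ≤ 1 →
      (M.scaleNorm ((1 - a) * (β - 2 * ℓ) + a) (M.coef e)).toReal ≤ Λ ^ (-(a / 2)) * N :=
    fun ha0 ha1 => M.toReal_scaleNorm_le hΛ hN0 hκ he1 hN1 hN2 ha0 ha1
  set a := (Δ + 1 - γ) / Δ with ha
  -- Since 1 - κ = Δ, the weight s/Δ produces the index s + κ of the noise term, and below the
  -- weight (Δ+1-γ)/Δ produces 2 - γ. The latter lies in [0,1] exactly when 1 ≤ γ ≤ Δ + 1, which is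
  -- where the rate saturates.
  have hi1 := hint (a := s / Δ) (div_nonneg (hM.s₀_nonneg.trans hs.1.le) hΔ.le)
    ((div_le_one hΔ).2 hsΔ)
  rw [show (1 - s / Δ) * (β - 2 * ℓ) + s / Δ = s + β - 2 * ℓ by
    rw [show β - 2 * ℓ = 1 - Δ by rw [hΔdef]; ring, show s + β - 2 * ℓ = s + 1 - Δ by
      rw [hΔdef]; ring]
    field_simp
    ring] at hi1
  have hi2 := hint (a := a) (div_nonneg (by linarith) hΔ.le) ((div_le_one hΔ).2 (by linarith))
  rw [show (1 - a) * (β - 2 * ℓ) + a = 2 - γ by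
    rw [show β - 2 * ℓ = 1 - Δ by rw [hΔdef]; ring, ha]
    field_simp
    ring] at hi2
  set Z := (M.scaleNorm (β - s) z).toReal with hZ
  have hZ0 : 0 ≤ Z := ENNReal.toReal_nonneg
  have hform1 : |M.form Λ w e - ⟪M.whitenedForward u, M.whitenedForward e⟫_ℝ| ≤
      C * Z * (Λ ^ (-(s / Δ / 2)) * N) := by
    have h := hC hΛ hu1 he1 hz hw
    have hfin : (C : ℝ≥0∞) * M.scaleNorm (β - s) z * M.scaleNorm (s + β - 2 * ℓ) (M.coef e) ≠ ∞ :=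
      ENNReal.mul_ne_top (ENNReal.mul_ne_top ENNReal.coe_ne_top hz.ne)
        (he1.mono (by linarith)).ne
    rw [ENNReal.ofReal_le_iff_le_toReal hfin, ENNReal.toReal_mul, ENNReal.toReal_mul] at h
    refine h.trans ?_
    rw [ENNReal.coe_toReal]
    gcongr
  have hform2 : |∑' k, M.lam k ^ (-2 : ℝ) * (M.coef u k * M.coef e k)| ≤
      U * (Λ ^ (-(a / 2)) * N) := by
    refine (M.abs_tsum_weight_mul_le hu (he1.mono (by linarith))).trans ?_
    gcongr
  have hform3 := hM.form_sub_left Λ hw1 hu1 he1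
  rw [← he, form_self Λ he1, form_eq M Λ u] at hform3
  have hlow : c * Eκ ≤ ‖M.whitenedForward e‖ := by
    have h := (hfw e (he1.mono hκ)).2.1
    have h2 := ENNReal.toReal_mono enorm_ne_top h
    rw [ENNReal.toReal_mul, toReal_enorm, ENNReal.coe_toReal] at h2
    exact h2
  have hpa : 0 < Λ ^ (-(a / 2)) := Real.rpow_pos_of_pos hΛ _
  have hps : 0 < Λ ^ (-(s / Δ / 2)) := Real.rpow_pos_of_pos hΛ _
  have hmN : m * N ^ 2 ≤ (C * Z * Λ ^ (-(s / Δ / 2)) + Λ * (U * Λ ^ (-(a / 2)))) * N := by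
    have g1 : m * Eκ ^ 2 ≤ ‖M.whitenedForward e‖ ^ 2 := by
      calc m * Eκ ^ 2 ≤ (c : ℝ) ^ 2 * Eκ ^ 2 := by gcongr; exact min_le_left _ _
        _ = (c * Eκ) ^ 2 := by ring
        _ ≤ _ := by gcongr
    have g2 : m * (Λ * E1 ^ 2) ≤ Λ * E1 ^ 2 :=
      mul_le_of_le_one_left (by positivity) (min_le_right _ _)
    have g3 := (abs_le.1 hform1).2
    have g4 := mul_le_mul_of_nonneg_left (abs_le.1 hform2).1 hΛ.le
    rw [hNsq]
    linarith
  have hNle : N ≤ m⁻¹ * (C * Z * Λ ^ (-(s / Δ / 2)) + Λ * (U * Λ ^ (-(a / 2)))) := by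
    rw [inv_mul_eq_div, le_div_iff₀ hm0]
    -- Cancelling one factor N needs N > 0; for N = 0 the bound is trivial.
    rcases hN0.eq_or_lt with h | h
    · rw [← h, zero_mul]; positivity
    · exact le_of_mul_le_mul_right (by rw [show N * m * N = m * N ^ 2 by ring]; exact hmN) h
  have hpow : Λ ^ (1 - a / 2) = Λ * Λ ^ (-(a / 2)) := by
    rw [sub_eq_add_neg, Real.rpow_add hΛ, Real.rpow_one]
  refine (hint hθ0 hθ1).trans ?_
  have hC0 : (0 : ℝ) ≤ C := C.coe_nonneg
  have hsum : C * Z * Λ ^ (-(s / Δ / 2)) + Λ * (U * Λ ^ (-(a / 2))) ≤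
      (C + U + 1) * (Λ ^ (1 - a / 2) + Λ ^ (-(s / Δ / 2)) * Z) := by
    rw [hpow]
    linarith [mul_nonneg hZ0 hps.le, mul_pos hΛ hpa, mul_nonneg hU0 (mul_nonneg hZ0 hps.le),
      mul_nonneg hC0 (mul_pos hΛ hpa).le]
  calc Λ ^ (-(θ / 2)) * N
      ≤ Λ ^ (-(θ / 2)) * (m⁻¹ * ((C + U + 1) * (Λ ^ (1 - a / 2) + Λ ^ (-(s / Δ / 2)) * Z))) := by
        refine mul_le_mul_of_nonneg_left (hNle.trans ?_) (Real.rpow_pos_of_pos hΛ _).le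
        exact mul_le_mul_of_nonneg_left hsum (inv_pos.2 hm0).le
    _ = _ := by ring

end Assumptions

end InverseProblem

namespace InverseProblem

variable {X : Type*} [NormedAddCommGroup X] [InnerProductSpace ℝ X] [CompleteSpace X]
variable {M : InverseProblem X}

/-! ### Convergence rates -/

lemma data_eq (u : X) (n : ℝ) (ξ : ℕ → ℝ) :
    M.data u n ξ = M.coef (M.Ainv u) + (√n)⁻¹ • ξ := rfl

namespace Assumptions

variable {s₀ β ℓ : ℝ} (hM : M.Assumptions s₀ β ℓ)
  {Ω : Type*} [MeasurableSpace Ω] {P : Measure Ω} {ξ : Ω → ℕ → ℝ}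
include hM

/-- For truncated data the posterior mean is a finite sum of fixed vectors with random scalar
coefficients, and these sums converge almost surely. -/
lemma aestronglyMeasurable_posteriorMean (hξ : M.IsNoise P ξ) {Λ : ℝ} (hΛ : 0 < Λ) (u : X) (n : ℝ)
    (hy : ∀ᵐ ω ∂P, M.MemScale (2 * β - 2 * ℓ - 1) (M.data u n (ξ ω))) :
    AEStronglyMeasurable (fun ω => M.posteriorMean β ℓ Λ (M.data u n (ξ ω))) P := by
  refine aestronglyMeasurable_of_tendsto_ae atTop (f := fun N ω =>
    ∑ j ∈ Finset.range N, M.data u n (ξ ω) j • M.posteriorMean β ℓ Λ (Pi.single j 1)) (fun N => ?_) ?_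
  · refine Finset.aestronglyMeasurable_fun_sum _ fun j _ => ?_
    refine AEStronglyMeasurable.smul_const (AEMeasurable.aestronglyMeasurable ?_) _
    exact ((hξ.hasLaw j).aemeasurable.const_mul _).const_add _
  · filter_upwards [hy] with ω hω
    exact hM.tendsto_posteriorMean_truncation hΛ hω

/-- The rates of convergence for `1 ≤ γ ≤ Δ + 1`. -/
lemma meanErrorRate [IsProbabilityMeasure P] (hξ : M.IsNoise P ξ) {γ : ℝ} (hγ1 : 1 ≤ γ)
    (hγ2 : γ ≤ 2 * ℓ - β + 1 + 1) {u : X} (hu : M.MemScale γ (M.coef u)) {θ : ℝ} (hθ0 : 0 ≤ θ)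
    (hθ1 : θ ≤ 1) {ε Δ : ℝ} (hε : 0 < ε) (hΔ : Δ = 2 * ℓ - β + 1) :
    M.MeanErrorRate β ℓ P ξ u ((1 - θ) * (β - 2 * ℓ) + θ)
      (fun n => n ^ (-((γ - 1 + s₀ + ε) / (2 * (Δ + γ - 1 + s₀ + ε)))))
      (fun n => n ^ (-((Δ + γ - 1 - θ * Δ) / (Δ + γ - 1 + s₀ + ε)))) := by
  have hs₀ := hM.s₀_nonneg
  have hΔ0 : 0 < Δ := hΔ ▸ hM.delta_pos
  -- The largest s ≤ s₀ + ε meeting the other constraints: s ≤ Δ for interpolation, β - s at least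
  -- the ceiling in the noise assumption, and s ≤ 1. Each of the four bounds exceeds s₀. An s below
  -- s₀ + ε only makes the variance smaller.
  set s := min (min (s₀ + ε) Δ) (min (β - ⌈β - s₀ - 1⌉) 1) with hs
  have hs1 : s ∈ Ioc s₀ 1 := by
    refine ⟨lt_min (lt_min (by linarith) (by linarith [hM.illposed])) (lt_min ?_ hM.s₀_lt_one),
      (min_le_right _ _).trans (min_le_right _ _)⟩
    linarith [Int.ceil_lt_add_one (β - s₀ - 1)]
  have hs2 : s ≤ Δ := (min_le_left _ _).trans (min_le_right _ _)
  have hs3 : (⌈β - s₀ - 1⌉ : ℝ) ≤ β - s := by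
    linarith [(min_le_right _ _ : s ≤ _).trans (min_le_left (β - (⌈β - s₀ - 1⌉ : ℝ)) 1)]
  have hs4 : s ≤ s₀ + ε := (min_le_left _ _).trans (min_le_left _ _)
  clear_value s
  obtain ⟨C, hC0, hC⟩ := hM.exists_error_le hs1 (hΔ ▸ hs2) hs3 hγ1 hγ2 hu
  rw [← hΔ] at hC
  have hE := hM.lintegral_scaleNorm_noise_lt_top hξ hs1.1 hs3
  set E := ∫⁻ ω, M.scaleNorm (β - s) (ξ ω) ^ 2 ∂P with hEdef
  have hmem : ∀ᵐ ω ∂P, M.MemScale (β - s) (ξ ω) := by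
    filter_upwards [ae_lt_top' (hξ.aemeasurable_scaleNorm_sq (β - s)) hE.ne] with ω hω
    by_contra h
    rw [MemScale, not_lt, top_le_iff] at h
    simp [h] at hω
  set G := Δ + γ - 1 + s₀ + ε with hG
  have hG0 : 0 < G := by linarith
  have hGΔ : G - Δ = γ - 1 + s₀ + ε := by rw [hG]; ring
  have hle : 2 * β - 2 * ℓ - 1 ≤ β - s := by linarith
  refine ⟨2 * C ^ 2 * (1 + E.toReal), by positivity, fun n hn => ?_⟩
  have hn0 : 0 < n := zero_lt_one.trans_le hn
  beta_reduce
  have hΛeq : 1 / (n * (n ^ (-((γ - 1 + s₀ + ε) / (2 * G)))) ^ 2) = n ^ (-(Δ / G)) := by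
    rw [← Real.rpow_mul_natCast hn0.le, one_div]
    nth_rewrite 1 [← Real.rpow_one n]
    rw [← Real.rpow_add hn0, ← Real.rpow_neg hn0.le, ← hGΔ]
    congr 1
    push_cast
    field_simp
    ring
  rw [hΛeq]
  set Λ := n ^ (-(Δ / G)) with hΛ
  have hΛ0 : 0 < Λ := Real.rpow_pos_of_pos hn0 _
  have hpow : ∀ t : ℝ, Λ ^ t = n ^ (-(Δ / G) * t) := fun t => by rw [hΛ, ← Real.rpow_mul hn0.le]
  have hdata : ∀ᵐ ω ∂P, M.MemScale (2 * β - 2 * ℓ - 1) (M.data u n (ξ ω)) := by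
    filter_upwards [hmem] with ω hω
    exact ((hM.memScale_Ainv hs1.1 hs3 (hu.mono hγ1)).add (hω.smul _)).mono hle
  refine ⟨?_, hM.aestronglyMeasurable_posteriorMean hξ hΛ0 u n hdata, ?_⟩
  · filter_upwards [hdata] with ω hω
    obtain ⟨w, hw⟩ := hM.exists_isPosteriorMean hΛ0 hω
    exact ⟨w, hw, fun w' hw' => hM.isPosteriorMean_unique hΛ0 hw' hw⟩
  set R := (Δ + γ - 1 - θ * Δ) / G with hR
  -- The squared bias is Λ^{(Δ+γ-1)/Δ - θ}, and Λ = n^{-Δ/G} turns it into exactly the claimed rate.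
  have hbias : (Λ ^ (-(θ / 2)) * Λ ^ (1 - (Δ + 1 - γ) / Δ / 2)) ^ 2 = n ^ (-R) := by
    rw [← Real.rpow_add hΛ0, ← Real.rpow_mul_natCast hΛ0.le, hpow]
    congr 1
    rw [hR]
    push_cast
    field_simp
    ring
  have hvar : (Λ ^ (-(θ / 2)) * (Λ ^ (-(s / Δ / 2)) * (√n)⁻¹)) ^ 2 ≤ n ^ (-R) := by
    rw [← mul_assoc, ← Real.rpow_add hΛ0, mul_pow, ← Real.rpow_mul_natCast hΛ0.le, hpow, inv_pow,
      Real.sq_sqrt hn0.le]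
    nth_rewrite 2 [← Real.rpow_one n]
    rw [← Real.rpow_neg hn0.le, ← Real.rpow_add hn0]
    refine Real.rpow_le_rpow_of_exponent_le hn ?_
    -- The variance exponent is (θΔ + s - G)/G; it is at most -R because G - s ≥ Δ + γ - 1, that is,
    -- s ≤ s₀ + ε.
    have : -(Δ / G) * ((-(θ / 2) + -(s / Δ / 2)) * ((2 : ℕ) : ℝ)) + -1 = (θ * Δ + s - G) / G := by
      push_cast
      field_simp
      ring
    rw [this, hR, ← neg_div]
    gcongr
    linarith
  have hpt : ∀ᵐ ω ∂P, M.scaleNorm ((1 - θ) * (β - 2 * ℓ) + θ)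
      (M.coef (M.posteriorMean β ℓ Λ (M.data u n (ξ ω)) - u)) ^ 2 ≤
      ENNReal.ofReal (2 * C ^ 2 * n ^ (-R)) * (1 + M.scaleNorm (β - s) (ξ ω) ^ 2) := by
    filter_upwards [hmem, hdata] with ω hω hyω
    have hpm := hM.isPosteriorMean_posteriorMean hΛ0 hyω
    rw [data_eq] at hpm ⊢
    obtain ⟨h1, h2⟩ := hC hΛ0 hθ0 hθ1 (hω.smul (√n)⁻¹) hpm
    have hfin := (h1.mono (show (1 - θ) * (β - 2 * ℓ) + θ ≤ 1 by
      nlinarith [hM.kappa_le_one])).ne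
    rw [scaleNorm_smul, ENNReal.toReal_mul, toReal_enorm, Real.norm_of_nonneg (by positivity)] at h2
    rw [← ENNReal.ofReal_toReal hfin, ← ENNReal.ofReal_toReal hω.ne,
      ← ENNReal.ofReal_pow ENNReal.toReal_nonneg, ← ENNReal.ofReal_pow ENNReal.toReal_nonneg,
      ← ENNReal.ofReal_one, ← ENNReal.ofReal_add zero_le_one (by positivity),
      ← ENNReal.ofReal_mul (by positivity)]
    refine ENNReal.ofReal_le_ofReal ?_
    set Z := (M.scaleNorm (β - s) (ξ ω)).toReal
    refine (pow_le_pow_left₀ ENNReal.toReal_nonneg h2 2).trans ?_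
    set p := Λ ^ (-(θ / 2)) * Λ ^ (1 - (Δ + 1 - γ) / Δ / 2) with hp
    set q := Λ ^ (-(θ / 2)) * (Λ ^ (-(s / Δ / 2)) * (√n)⁻¹) with hq
    calc _ = C ^ 2 * (p + q * Z) ^ 2 := by rw [hp, hq]; ring
      _ ≤ C ^ 2 * (2 * (p ^ 2 + q ^ 2 * Z ^ 2)) := by
          gcongr
          nlinarith [sq_nonneg (p - q * Z)]
      _ ≤ C ^ 2 * (2 * (n ^ (-R) + n ^ (-R) * Z ^ 2)) := by
          rw [hbias]
          gcongr
      _ = _ := by ring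
  calc _ ≤ ∫⁻ ω, ENNReal.ofReal (2 * C ^ 2 * n ^ (-R)) * (1 + M.scaleNorm (β - s) (ξ ω) ^ 2) ∂P :=
        lintegral_mono_ae hpt
    _ = ENNReal.ofReal (2 * C ^ 2 * n ^ (-R)) * (1 + E) := by
        rw [lintegral_const_mul' _ _ ENNReal.ofReal_ne_top, lintegral_add_left measurable_const,
          lintegral_const, measure_univ, one_mul]
    _ = _ := by
        nth_rewrite 1 [← ENNReal.ofReal_toReal hE.ne]
        rw [← ENNReal.ofReal_one, ← ENNReal.ofReal_add zero_le_one ENNReal.toReal_nonneg,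
          ← ENNReal.ofReal_mul (by positivity)]
        congr 1
        ring

end Assumptions

end InverseProblem

/-! ### The three regimes of the smoothness γ -/

theorem theorem2p2 {X : Type*} [NormedAddCommGroup X] [InnerProductSpace ℝ X] [CompleteSpace X]
    (M : InverseProblem X) (s₀ β ℓ Δ : ℝ) (hM : M.Assumptions s₀ β ℓ) (hΔ : Δ = 2 * ℓ - β + 1)
    {Ω : Type*} [MeasurableSpace Ω] (P : Measure Ω) [IsProbabilityMeasure P]
    (ξ : Ω → ℕ → ℝ) (hξ : M.IsNoise P ξ)
    (γ : ℝ) (hγ : 1 ≤ γ) (u : X) (hu : M.MemScale γ (M.coef u))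
    (θ η : ℝ) (hθ : θ ∈ Icc (0 : ℝ) 1) (hη : η = (1 - θ) * (β - 2 * ℓ) + θ)
    (ε : ℝ) (hε : 0 < ε) :
    (γ ∈ Ioc 1 (Δ + 1) →
      M.MeanErrorRate β ℓ P ξ u η
        (fun n => n ^ (-((γ - 1 + s₀ + ε) / (2 * (Δ + γ - 1 + s₀ + ε)))))
        (fun n => n ^ (-((Δ + γ - 1 - θ * Δ) / (Δ + γ - 1 + s₀ + ε))))) ∧
    (Δ + 1 < γ →
      M.MeanErrorRate β ℓ P ξ u η
        (fun n => n ^ (-((Δ + s₀ + ε) / (2 * (2 * Δ + s₀ + ε)))))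
        (fun n => n ^ (-(((2 - θ) * Δ) / (2 * Δ + s₀ + ε))))) ∧
    (γ = 1 → θ < 1 →
      M.MeanErrorRate β ℓ P ξ u η
        (fun n => n ^ (-((s₀ + ε) / (2 * (Δ + s₀ + ε)))))
        (fun n => n ^ (-(((1 - θ) * Δ) / (Δ + s₀ + ε))))) := by
  have hΔ0 : 0 < Δ := hΔ ▸ hM.delta_pos
  subst hη
  refine ⟨fun h => ?_, fun h => ?_, fun h _ => ?_⟩
  · exact hM.meanErrorRate hξ hγ (hΔ ▸ h.2) hu hθ.1 hθ.2 hε hΔ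
  -- Saturation: smoothness beyond Δ + 1 is discarded through the embedding of X^γ in X^{Δ+1}.
  · have h1 := hM.meanErrorRate hξ (γ := Δ + 1) (by linarith) (by linarith) (hu.mono h.le)
      hθ.1 hθ.2 hε hΔ
    rwa [show Δ + 1 - 1 + s₀ + ε = Δ + s₀ + ε by ring,
      show Δ + (Δ + 1) - 1 + s₀ + ε = 2 * Δ + s₀ + ε by ring,
      show Δ + (Δ + 1) - 1 - θ * Δ = (2 - θ) * Δ by ring] at h1
  · subst h
    have h1 := hM.meanErrorRate hξ le_rfl (by linarith) hu hθ.1 hθ.2 hε hΔ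
    rwa [show 1 - 1 + s₀ + ε = s₀ + ε by ring, show Δ + 1 - 1 + s₀ + ε = Δ + s₀ + ε by ring,
      show Δ + 1 - 1 - θ * Δ = (1 - θ) * Δ by ring] at h1
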